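/- Let $\mathbb{R}^{4,2}$ be $\mathbb{R}^6$ with a metric $\langle\cdot,\cdot\rangle$ of signature $(4,2)$. An oriented $2$-sphere is a point $\mathrm{span}(s)$ of the projective light cone, that is, $s\neq0$ and $\langle s,s\rangle=0$. A contact element is a $2$-dimensional totally null subspace, and a Legendre map is a smooth family $f$ of contact elements, parametrized by a smooth surface $M$, with $\langle s,dt\rangle=0$ for all local sections $s,t$ of $f$. Two Legendre maps $f,\hat f$ on $M$ form a Ribaucour pair if $f(x)\cap\hat f(x)$ is one-dimensional for every $x\in M$ and their curvature directions coincide, where $0\neq v\in T_xM$ is a curvature direction of $f$ if some local section $s$ of $f$ with $s(x)\neq0$ satisfies $ds_x(v)\in f(x)$. For a non-null vector $b$, the Lie inversion is $\sigma_b(r)=r-\frac{2\langle r,b\rangle}{\langle b,b\rangle}b$. Fix a point sphere complex $p$, $\langle p,p\rangle=-1$. The point sphere of a contact element $F$ is $F\cap p^\perp$. Two spheres $s,t$ intersect orthogonally if $\langle s,t+\langle t,p\rangle p\rangle=0$. A circle is a $3$-dimensional subspace $\gamma\subset p^\perp$ of signature $(2,1)$, and a sphere $s$ intersects it orthogonally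 if $s$ intersects all spheres in $\gamma^\perp$ orthogonally. Let $a$ be non-null, let $f$ and $\hat f=\sigma_a(f)$ be a Ribaucour pair, and suppose that the point spheres of $f(x)$ and $\hat f(x)$ are distinct for every $x\in M$. With $r=f\cap\hat f$, let $$\gamma=\mathrm{span}\bigl(f\cap p^\perp,\ \hat f\cap p^\perp,\ r+\langle r,p\rangle p\bigr)$$ be the associated circle congruence. A Legendre map $g$ on $M$ is called orthogonal to $\gamma$ if, for every $x\in M$, all spheres of $g(x)$ intersect $\gamma(x)$ orthogonally. Then: 1. Each $\gamma(x)$ is a circle. 2. For every non-null $b\in\mathrm{span}(a,p)$, $\sigma_b(f)$ is a Legendre map orthogonal to $\gamma$. If $\sigma_b(f(x))=\sigma_{b'}(f(x))$ for non-null $b,b'\in\mathrm{span}(a,p)$ and some $x\in M$, then $\mathrm{span}(b)=\mathrm{span}(b')$. 3. For every null vector $b\neq0$ in $\mathrm{span}(a,p)$, the totally umbilic family $x\mapsto (f(x)\cap b^\perp)+\mathrm{span}(b)$ of contact elements of the sphere $b$ is a Legendre map orthogonal to $\gamma$. 4. If $M$ is connected, then the Legendre maps orthogonal to $\gamma$ are,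 up to a change of orientation (that is, up to applying $\sigma_p$), exactly the maps in 2 and 3. -/

import Mathlib

open scoped Manifold ContDiff

namespace LieSphere

/-- The six-dimensional vector space underlying `ℝ^{4,2}`. -/
abbrev R42 : Type := Fin 6 → ℝ

/-- The metric of signature `(4,2)` on `R42`. -/
noncomputable def lieForm : LinearMap.BilinForm ℝ R42 :=
  Matrix.toBilin' (Matrix.diagonal ![1, 1, 1, 1, -1, -1])

/-- The orthogonal complement `⟨b⟩^⊥` of a vector. -/
noncomputable def perp (b : R42) : Submodule ℝ R42 :=
  lieForm.orthogonal (Submodule.span ℝ {b})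

/-- `s` is a homogeneous coordinate vector of an oriented sphere: a nonzero lightlike vector. -/
def IsSphere (s : R42) : Prop := s ≠ 0 ∧ lieForm s s = 0

/-- A contact element: a two-dimensional totally lightlike subspace, that is, a line in the
Lie quadric. -/
def IsContactElement (F : Submodule ℝ R42) : Prop :=
  Module.finrank ℝ F = 2 ∧ ∀ s ∈ F, ∀ t ∈ F, lieForm s t = 0

/-- The Lie inversion `σ_b` with respect to the linear sphere complex of `b`
(used only for non-null `b`). -/
noncomputable def lieInversion (b : R42) : R42 →ₗ[ℝ] R42 :=
  LinearMap.id - (2 / lieForm b b) • (lieForm.flip b).smulRight b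

/-- The image `σ_b(F)` of a contact element. -/
noncomputable def invert (b : R42) (F : Submodule ℝ R42) : Submodule ℝ R42 :=
  F.map (lieInversion b)

/-- The contact element that contains the sphere `b` and the sphere of `F` in oriented contact
with `b` (used only for null `b` with `b ∉ F`). -/
noncomputable def umbilicElement (b : R42) (F : Submodule ℝ R42) : Submodule ℝ R42 :=
  (F ⊓ perp b) ⊔ Submodule.span ℝ {b}

section Moebius

/-- The point sphere of a contact element with respect to the point sphere complex `p`. -/
noncomputable def pointSphere (p : R42) (F : Submodule ℝ R42) : Submodule ℝ R42 :=
  F ⊓ perp p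

/-- Two spheres intersect orthogonally (with respect to the point sphere complex `p`). -/
def SpheresOrthogonal (p s t : R42) : Prop :=
  lieForm s (t + lieForm t p • p) = 0

/-- A `(2,1)`-plane: a three-dimensional subspace of signature `(2,1)`. -/
def IsPlane21 (W : Submodule ℝ R42) : Prop :=
  ∃ e : Fin 3 → R42, W = Submodule.span ℝ (Set.range e) ∧
    ∀ i j, lieForm (e i) (e j) = Matrix.diagonal ![(1 : ℝ), 1, -1] i j

/-- A circle `(γ, γ^⊥)`, represented by its `(2,1)`-plane `γ` orthogonal to `p`. -/
def IsCircle (p : R42) (γ : Submodule ℝ R42) : Prop :=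
  IsPlane21 γ ∧ γ ≤ perp p

/-- The circle `(γ, γ^⊥)` intersects the sphere `s` orthogonally: `s` intersects all spheres
in `γ^⊥` orthogonally. -/
def CircleOrthogonal (p : R42) (γ : Submodule ℝ R42) (s : R42) : Prop :=
  ∀ v ∈ lieForm.orthogonal γ, IsSphere v → SpheresOrthogonal p s v

/-- The linear map `s ↦ s + ⟨s,p⟩ p`. -/
noncomputable def pointProjection (p : R42) : R42 →ₗ[ℝ] R42 :=
  LinearMap.id + (lieForm.flip p).smulRight p

/-- For contact elements `F`, `G` with common sphere `r`: the span of the point spheres of `F`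
and `G` and of `r + ⟨r,p⟩ p`, that is, the circle through the two point spheres which
intersects `r` orthogonally. -/
noncomputable def associatedCircle (p : R42) (F G : Submodule ℝ R42) : Submodule ℝ R42 :=
  pointSphere p F ⊔ pointSphere p G ⊔ (F ⊓ G).map (pointProjection p)

end Moebius

section Legendre

variable {M : Type*} [TopologicalSpace M] [ChartedSpace (EuclideanSpace ℝ (Fin 2)) M]

/-- `s` is a smooth section of `f` over the open set `U`. -/
def IsSection (f : M → Submodule ℝ R42) (U : Set M) (s : M → R42) : Prop :=
  ContMDiffOn (𝓡 2) 𝓘(ℝ, R42) ∞ s U ∧ ∀ x ∈ U, s x ∈ f x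

/-- The derivative of an `R42`-valued map at `x` in the direction `v`. -/
noncomputable def sectionDeriv (s : M → R42) (x : M) (v : TangentSpace (𝓡 2) x) : R42 :=
  mfderiv (𝓡 2) 𝓘(ℝ, R42) s x v

/-- A Legendre map: a smooth family of contact elements (smooth: locally spanned by smooth
sections) such that `⟨s, dt⟩ = 0` for all local sections `s`, `t`. -/
def IsLegendreMap (f : M → Submodule ℝ R42) : Prop :=
  (∀ x, IsContactElement (f x)) ∧
  (∀ x, ∃ U : Set M, IsOpen U ∧ x ∈ U ∧ ∃ s t : M → R42, IsSection f U s ∧ IsSection f U t ∧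
    ∀ y ∈ U, f y = Submodule.span ℝ {s y, t y}) ∧
  (∀ U : Set M, IsOpen U → ∀ s t : M → R42, IsSection f U s → IsSection f U t →
    ∀ x ∈ U, ∀ v : TangentSpace (𝓡 2) x, lieForm (s x) (sectionDeriv t x v) = 0)

/-- `v` is a curvature direction of `f` at `x`: along `v`, some sphere of the contact element
`f x` (the curvature sphere) is stationary modulo `f x`. -/
def IsCurvatureDirection (f : M → Submodule ℝ R42) (x : M) (v : TangentSpace (𝓡 2) x) : Prop :=
  v ≠ 0 ∧ ∃ U : Set M, IsOpen U ∧ x ∈ U ∧ ∃ s : M → R42, IsSection f U s ∧ s x ≠ 0 ∧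
    sectionDeriv s x v ∈ f x

/-- A Ribaucour pair: two Legendre maps that envelop a common sphere congruence `x ↦ f x ⊓ g x`
such that curvature lines correspond. -/
def IsRibaucourPair (f g : M → Submodule ℝ R42) : Prop :=
  IsLegendreMap f ∧ IsLegendreMap g ∧ (∀ x, Module.finrank ℝ ↥(f x ⊓ g x) = 1) ∧
  ∀ x v, IsCurvatureDirection f x v ↔ IsCurvatureDirection g x v

/-- A family `g` of contact elements is orthogonal to a circle congruence `γ` on the same
parameter surface: each sphere of `g x` intersects the circle `γ x` orthogonally. -/
def OrthogonalTo (p : R42) (g γ : M → Submodule ℝ R42) : Prop :=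
  ∀ x, ∀ s ∈ g x, s ≠ 0 → CircleOrthogonal p (γ x) s

/-- The circle congruence associated to a Ribaucour pair. -/
noncomputable def circleCongruence (p : R42) (f g : M → Submodule ℝ R42) :
    M → Submodule ℝ R42 :=
  fun x => associatedCircle p (f x) (g x)

/-- The image `σ_b(f)` of a family of contact elements. -/
noncomputable def invertMap (b : R42) (f : M → Submodule ℝ R42) : M → Submodule ℝ R42 :=
  fun x => invert b (f x)

/-- The sphere `b`, regarded as a totally umbilic family of contact elements. -/
noncomputable def umbilicMap (b : R42) (f : M → Submodule ℝ R42) : M → Submodule ℝ R42 :=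
  fun x => umbilicElement b (f x)

end Legendre

/-- Representatives of the set `C_a`: the non-null vectors in `span(a, p)`. -/
def nonnullSpan (a p : R42) : Set R42 :=
  {b | b ∈ Submodule.span ℝ {a, p} ∧ lieForm b b ≠ 0}

/-- The spheres in `span(a, p)`: its nonzero null vectors. -/
def nullSpan (a p : R42) : Set R42 :=
  {b | b ∈ Submodule.span ℝ {a, p} ∧ IsSphere b}

end LieSphere

namespace LieSphere

/-! Everything takes place in the four-space `W(x) = f(x) ⊔ span(a, p)`. A nonzero vector of `f(x)`
orthogonal to both `a` and `p` would be a common point sphere of `f(x)` and `σ_a(f(x))`; since these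
differ, `f(x)` has a unique basis `q`, `r` dual to `a`, `p`. Hence `W(x)` is nondegenerate of
signature (2,2), and its complement is positive definite.

The circle is `W(x) ∩ p^⊥`, so its complement is `W(x)^⊥ + span(p)`. A sphere there projects along
`p` to an arbitrary vector of `W(x)^⊥`, and therefore a sphere is orthogonal to the circle exactly
when it lies in `W(x)` (`circleOrthogonal_iff`). Maps orthogonal to the congruence are thus families
of null planes in `W(x)`.

Pointwise, these planes form two families interchanged by the reflection `σ_p`. Up to this
reflection a plane meets `f(x)`, and then it is `σ_b(f(x))` or an umbilic element with `b` in
`span(a, p)` (`exists_eq_of_le`).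

Globally, the Legendre condition makes `dq` and `dr` orthogonal to `W`, so the frame `q`, `r`, `a`,
`p` is parallel for the connection induced on `W`. For a Legendre map `g` in `W`, derivatives of
sections are orthogonal to `g`; projected to `W` they lie in `g`, which is maximal null there. So
`g` is constant in the parallel frame (`isLocallyConstant`), and on a connected surface its value at
one point determines it. -/

/-! ### The metric, Lie inversions and contact elements. -/

theorem lieForm_apply (u v : R42) : lieForm u v =
    u 0 * v 0 + u 1 * v 1 + u 2 * v 2 + u 3 * v 3 - u 4 * v 4 - u 5 * v 5 := by
  simp [lieForm, Matrix.toBilin'_apply', Matrix.mulVec_diagonal, dotProduct, Fin.sum_univ_six]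
  ring

theorem lieForm_comm (u v : R42) : lieForm u v = lieForm v u := by
  simp only [lieForm_apply]; ring

theorem mem_perp {b v : R42} : v ∈ perp b ↔ lieForm v b = 0 := by
  rw [perp, LinearMap.BilinForm.mem_orthogonal_iff]
  constructor
  · intro h
    rw [lieForm_comm]
    exact h b (Submodule.mem_span_singleton_self b)
  · rintro h n hn
    obtain ⟨c, rfl⟩ := Submodule.mem_span_singleton.1 hn
    simp [lieForm_comm b v, h]

/-- A three-dimensional subspace of `R42` is not negative semidefinite. -/
theorem exists_combination_eq_zero (u₁ u₂ u₃ : R42)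
    (h : ∀ α β γ : ℝ, lieForm (α • u₁ + β • u₂ + γ • u₃) (α • u₁ + β • u₂ + γ • u₃) ≤ 0) :
    ∃ α β γ : ℝ, ¬(α = 0 ∧ β = 0 ∧ γ = 0) ∧ α • u₁ + β • u₂ + γ • u₃ = 0 := by
  let T : (Fin 3 → ℝ) →ₗ[ℝ] (Fin 2 → ℝ) :=
    (LinearMap.funLeft ℝ ℝ ![4, 5]).comp (Fintype.linearCombination ℝ ![u₁, u₂, u₃])
  -- Two linear conditions on three coefficients: some nontrivial combination has vanishing negative
  -- coordinates, and on such vectors the metric is positive definite.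
  have hT : LinearMap.ker T ≠ ⊥ := LinearMap.ker_ne_bot_of_finrank_lt (by simp)
  obtain ⟨c, hc, hc0⟩ := (Submodule.ne_bot_iff _).1 hT
  refine ⟨c 0, c 1, c 2, ?_, ?_⟩
  · rintro ⟨h0, h1, h2⟩
    exact hc0 (by ext i; fin_cases i <;> simpa)
  · have hn := h (c 0) (c 1) (c 2)
    have hc' : T c = 0 := hc
    have h4 := congrFun hc' 0
    have h5 := congrFun hc' 1
    simp only [T, LinearMap.comp_apply, LinearMap.funLeft_apply, Fintype.linearCombination_apply,
      Fin.sum_univ_three, Matrix.cons_val_zero, Matrix.cons_val_one, Matrix.cons_val,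
      Pi.zero_apply] at h4 h5
    generalize c 0 • u₁ + c 1 • u₂ + c 2 • u₃ = w at *
    rw [lieForm_apply, h4, h5] at hn
    have h0 : w 0 = 0 := by nlinarith [sq_nonneg (w 0), sq_nonneg (w 1), sq_nonneg (w 2), sq_nonneg (w 3)]
    have h1 : w 1 = 0 := by nlinarith [sq_nonneg (w 0), sq_nonneg (w 1), sq_nonneg (w 2), sq_nonneg (w 3)]
    have h2 : w 2 = 0 := by nlinarith [sq_nonneg (w 0), sq_nonneg (w 1), sq_nonneg (w 2), sq_nonneg (w 3)]
    have h3 : w 3 = 0 := by nlinarith [sq_nonneg (w 0), sq_nonneg (w 1), sq_nonneg (w 2), sq_nonneg (w 3)]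
    ext i
    fin_cases i <;> assumption

theorem lieInversion_apply (b v : R42) :
    lieInversion b v = v - (2 * lieForm v b / lieForm b b) • b := by
  simp [lieInversion, smul_smul]
  congr 1; ring

theorem lieInversion_of_perp {b v : R42} (h : lieForm v b = 0) : lieInversion b v = v := by
  simp [lieInversion_apply, h]

theorem lieForm_lieInversion {b : R42} (hb : lieForm b b ≠ 0) (u v : R42) :
    lieForm (lieInversion b u) (lieInversion b v) = lieForm u v := by
  simp only [lieInversion_apply, map_sub, map_smul, LinearMap.sub_apply, LinearMap.smul_apply,
    smul_eq_mul, lieForm_comm b v]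
  field_simp
  ring

theorem lieInversion_lieInversion {b : R42} (hb : lieForm b b ≠ 0) (v : R42) :
    lieInversion b (lieInversion b v) = v := by
  have h : 2 * lieForm b b / lieForm b b = 2 := by field_simp
  simp only [lieInversion_apply, map_sub, map_smul, h]
  module

theorem lieInversion_injective {b : R42} (hb : lieForm b b ≠ 0) :
    Function.Injective (lieInversion b) :=
  Function.LeftInverse.injective (lieInversion_lieInversion hb)

theorem mem_invert {b : R42} (hb : lieForm b b ≠ 0) {F : Submodule ℝ R42} {v : R42} :
    v ∈ invert b F ↔ lieInversion b v ∈ F := by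
  constructor
  · rintro ⟨u, hu, rfl⟩
    rwa [lieInversion_lieInversion hb]
  · intro h
    exact ⟨_, h, lieInversion_lieInversion hb v⟩

theorem invert_invert {b : R42} (hb : lieForm b b ≠ 0) (F : Submodule ℝ R42) :
    invert b (invert b F) = F := by
  ext v
  rw [mem_invert hb, mem_invert hb, lieInversion_lieInversion hb]

theorem IsContactElement.invert {b : R42} (hb : lieForm b b ≠ 0) {F : Submodule ℝ R42}
    (hF : IsContactElement F) : IsContactElement (invert b F) := by
  refine ⟨?_, fun s hs t ht => ?_⟩
  · exact (Submodule.equivMapOfInjective _ (lieInversion_injective hb) F).finrank_eq.symm.trans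
      hF.1
  · rw [← lieForm_lieInversion hb]
    exact hF.2 _ ((mem_invert hb).1 hs) _ ((mem_invert hb).1 ht)

theorem finrank_span_pair {u v : R42} (h : ∀ α β : ℝ, α • u + β • v = 0 → α = 0 ∧ β = 0) :
    Module.finrank ℝ (Submodule.span ℝ {u, v}) = 2 := by
  have := finrank_span_eq_card (LinearIndependent.pair_iff.2 h)
  rwa [Matrix.range_cons_cons_empty, Fintype.card_fin] at this

/-- A contact element is the span of any two of its independent spheres. -/
theorem IsContactElement.eq_span {F : Submodule ℝ R42} (hF : IsContactElement F) {u v : R42}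
    (hu : u ∈ F) (hv : v ∈ F) (h : ∀ α β : ℝ, α • u + β • v = 0 → α = 0 ∧ β = 0) :
    F = Submodule.span ℝ {u, v} := by
  symm
  apply Submodule.eq_of_le_of_finrank_eq
  · rw [Submodule.span_le]
    rintro w (rfl | rfl) <;> assumption
  · rw [finrank_span_pair h, hF.1]

/-- Two spheres of a contact element that are both point spheres coincide. -/
theorem IsContactElement.pointSphere_eq {p : R42} (hp : lieForm p p = -1) {F : Submodule ℝ R42}
    (hF : IsContactElement F) {u : R42} (hu : u ∈ F) (hup : lieForm u p = 0) (hu0 : u ≠ 0) :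
    pointSphere p F = Submodule.span ℝ {u} := by
  apply le_antisymm
  · rintro v ⟨hv, hvp⟩
    rw [SetLike.mem_coe, mem_perp] at hvp
    -- The span of `u`, `v`, `p` is negative semidefinite, so the three vectors are dependent;
    -- pairing with `p` removes `p` from the relation.
    obtain ⟨α, β, γ, hne, h⟩ := exists_combination_eq_zero u v p (fun α β γ => by
      have h1 := hF.2 u hu u hu
      have h2 := hF.2 v hv v hv
      have h3 := hF.2 u hu v hv
      simp only [map_add, map_smul, LinearMap.add_apply, LinearMap.smul_apply, smul_eq_mul,
        lieForm_comm v u, lieForm_comm p u, lieForm_comm p v, h1, h2, h3, hp, hup, hvp]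
      nlinarith [sq_nonneg γ])
    have hγ : γ = 0 := by
      have := congrArg (fun w => lieForm w p) h
      simpa [hup, hvp, hp] using this
    subst hγ
    have hβ : β ≠ 0 := by
      rintro rfl
      simp only [zero_smul, add_zero, smul_eq_zero, hu0, or_false] at h
      simp [h] at hne
    rw [Submodule.mem_span_singleton]
    refine ⟨-(β⁻¹ * α), ?_⟩
    have : v = β⁻¹ • (β • v) := by rw [smul_smul, inv_mul_cancel₀ hβ, one_smul]
    rw [this]
    have h' : β • v = -(α • u) := by
      rw [zero_smul, add_zero] at h
      exact eq_neg_of_add_eq_zero_right h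
    rw [h']
    module
  · rw [Submodule.span_le]
    rintro _ rfl
    exact ⟨hu, mem_perp.2 hup⟩

/-! ### The dual frame and the four-space `F ⊔ span(a, p)`. -/

/-- The basis `q`, `r` of a contact element `F` that is dual to the vectors `a`, `p`. -/
structure IsDualFrame (a p : R42) (F : Submodule ℝ R42) (q r : R42) : Prop where
  eq_span : F = Submodule.span ℝ {q, r}
  qq : lieForm q q = 0
  rr : lieForm r r = 0
  qr : lieForm q r = 0
  qa : lieForm q a = 1
  qp : lieForm q p = 0
  ra : lieForm r a = 0
  rp : lieForm r p = 1

/-- The point spheres of `F` and `σ_a(F)` differ only if `F` is dual to `span(a, p)`. -/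
theorem eq_zero_of_perp {a p : R42} (hp : lieForm p p = -1) (ha : lieForm a a ≠ 0)
    {F : Submodule ℝ R42} (hF : IsContactElement F)
    (hpt : pointSphere p F ≠ pointSphere p (invert a F)) {u : R42} (hu : u ∈ F)
    (hua : lieForm u a = 0) (hup : lieForm u p = 0) : u = 0 := by
  by_contra hu0
  apply hpt
  rw [hF.pointSphere_eq hp hu hup hu0, (hF.invert ha).pointSphere_eq hp _ hup hu0]
  rwa [mem_invert ha, lieInversion_of_perp hua]

/-- Pairing with `a` and `p` is injective on the two-dimensional `F` by `eq_zero_of_perp`, hence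
bijective onto pairs of numbers; `q` and `r` are the preimages of the unit vectors. -/
theorem exists_isDualFrame {a p : R42} (hp : lieForm p p = -1) (ha : lieForm a a ≠ 0)
    {F : Submodule ℝ R42} (hF : IsContactElement F)
    (hpt : pointSphere p F ≠ pointSphere p (invert a F)) : ∃ q r, IsDualFrame a p F q r := by
  let T : F →ₗ[ℝ] (Fin 2 → ℝ) :=
    LinearMap.pi ![(lieForm.flip a).comp F.subtype, (lieForm.flip p).comp F.subtype]
  have hT : Function.Injective T := by
    rw [← LinearMap.ker_eq_bot, LinearMap.ker_eq_bot']
    intro u hu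
    have h0 := congrFun hu 0
    have h1 := congrFun hu 1
    exact Subtype.ext (eq_zero_of_perp hp ha hF hpt u.2 (by simpa [T] using h0)
      (by simpa [T] using h1))
  have hT' : Function.Surjective T :=
    (LinearMap.injective_iff_surjective_of_finrank_eq_finrank (by simp [hF.1])).1 hT
  obtain ⟨q, hq⟩ := hT' ![1, 0]
  obtain ⟨r, hr⟩ := hT' ![0, 1]
  have qa : lieForm q a = 1 := by simpa [T] using congrFun hq 0
  have qp : lieForm q p = 0 := by simpa [T] using congrFun hq 1
  have ra : lieForm r a = 0 := by simpa [T] using congrFun hr 0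
  have rp : lieForm r p = 1 := by simpa [T] using congrFun hr 1
  refine ⟨q, r, ?_, hF.2 _ q.2 _ q.2, hF.2 _ r.2 _ r.2, hF.2 _ q.2 _ r.2, qa, qp, ra, rp⟩
  apply hF.eq_span q.2 r.2
  intro α β h
  have h1 := congrArg (fun w => lieForm w a) h
  have h2 := congrArg (fun w => lieForm w p) h
  simp only [map_add, map_smul, LinearMap.add_apply, LinearMap.smul_apply, smul_eq_mul, qa, qp,
    ra, rp, map_zero, LinearMap.zero_apply] at h1 h2
  constructor <;> linarith

namespace IsDualFrame

variable {a p q r : R42} {F : Submodule ℝ R42}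

theorem rq (h : IsDualFrame a p F q r) : lieForm r q = 0 := lieForm_comm q r ▸ h.qr
theorem aq (h : IsDualFrame a p F q r) : lieForm a q = 1 := lieForm_comm q a ▸ h.qa
theorem pq (h : IsDualFrame a p F q r) : lieForm p q = 0 := lieForm_comm q p ▸ h.qp
theorem ar (h : IsDualFrame a p F q r) : lieForm a r = 0 := lieForm_comm r a ▸ h.ra
theorem pr (h : IsDualFrame a p F q r) : lieForm p r = 1 := lieForm_comm r p ▸ h.rp

theorem mem_iff (h : IsDualFrame a p F q r) {v : R42} : v ∈ F ↔ ∃ α β : ℝ, v = α • q + β • r := by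
  rw [h.eq_span, Submodule.mem_span_pair]
  simp only [eq_comm]

theorem left_mem (h : IsDualFrame a p F q r) : q ∈ F := h.mem_iff.2 ⟨1, 0, by simp⟩
theorem right_mem (h : IsDualFrame a p F q r) : r ∈ F := h.mem_iff.2 ⟨0, 1, by simp⟩

theorem eq_combination (h : IsDualFrame a p F q r) {v : R42} (hv : v ∈ F) :
    v = lieForm v a • q + lieForm v p • r := by
  obtain ⟨α, β, rfl⟩ := h.mem_iff.1 hv
  simp [h.qa, h.qp, h.ra, h.rp]

theorem mem_sup_iff (h : IsDualFrame a p F q r) {v : R42} :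
    v ∈ F ⊔ Submodule.span ℝ {a, p} ↔
      ∃ α β γ δ : ℝ, v = α • q + β • r + γ • a + δ • p := by
  rw [Submodule.mem_sup]
  constructor
  · rintro ⟨u, hu, w, hw, rfl⟩
    obtain ⟨α, β, rfl⟩ := h.mem_iff.1 hu
    obtain ⟨γ, δ, rfl⟩ := Submodule.mem_span_pair.1 hw
    exact ⟨α, β, γ, δ, by module⟩
  · rintro ⟨α, β, γ, δ, rfl⟩
    exact ⟨_, h.mem_iff.2 ⟨α, β, rfl⟩, _, Submodule.mem_span_pair.2 ⟨γ, δ, rfl⟩, by module⟩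

/-- Orthogonal projection to `F ⊔ span(a, p)`. -/
theorem exists_sub_perp (h : IsDualFrame a p F q r) (hp : lieForm p p = -1) (v : R42) :
    ∃ w ∈ F ⊔ Submodule.span ℝ {a, p}, lieForm (v - w) q = 0 ∧ lieForm (v - w) r = 0 ∧
      lieForm (v - w) a = 0 ∧ lieForm (v - w) p = 0 := by
  -- The products with `q` and `r` see only the `a` and `p` components and force those coefficients;
  -- the products with `a` and `p` then determine the other two.
  refine ⟨(lieForm v a - lieForm a a * lieForm v q - lieForm a p * lieForm v r) • q +
    (lieForm v p - lieForm a p * lieForm v q + lieForm v r) • r + lieForm v q • a +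
    lieForm v r • p, h.mem_sup_iff.2 ⟨_, _, _, _, rfl⟩, ?_, ?_, ?_, ?_⟩ <;>
  · simp only [map_add, map_sub, LinearMap.sub_apply, map_smul, LinearMap.add_apply,
      LinearMap.smul_apply, smul_eq_mul, hp, h.qq, h.rr, h.qr, h.qa, h.qp, h.ra, h.rp, h.rq, h.aq,
      h.pq, h.ar, h.pr, lieForm_comm p a]
    ring

theorem lieForm_eq_zero_of_mem (h : IsDualFrame a p F q r) {w u : R42}
    (hu : u ∈ F ⊔ Submodule.span ℝ {a, p}) (hq : lieForm w q = 0) (hr : lieForm w r = 0)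
    (ha : lieForm w a = 0) (hp : lieForm w p = 0) : lieForm u w = 0 := by
  obtain ⟨α, β, γ, δ, rfl⟩ := h.mem_sup_iff.1 hu
  rw [lieForm_comm]
  simp [hq, hr, ha, hp]

theorem eq_zero_of_mem (h : IsDualFrame a p F q r) (hp : lieForm p p = -1) {w : R42}
    (hw : w ∈ F ⊔ Submodule.span ℝ {a, p}) (h1 : lieForm w q = 0) (h2 : lieForm w r = 0)
    (h3 : lieForm w a = 0) (h4 : lieForm w p = 0) : w = 0 := by
  obtain ⟨α, β, γ, δ, rfl⟩ := h.mem_sup_iff.1 hw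
  simp only [map_add, map_smul, LinearMap.add_apply,
      LinearMap.smul_apply, smul_eq_mul, hp, h.qq, h.rr, h.qr, h.qa, h.qp, h.ra, h.rp, h.rq, h.aq,
      h.pq, h.ar, h.pr, lieForm_comm p a] at h1 h2 h3 h4
  have hγ : γ = 0 := by linarith
  have hδ : δ = 0 := by linarith
  subst hγ hδ
  have hα : α = 0 := by linarith
  have hβ : β = 0 := by linarith
  simp [hα, hβ]

end IsDualFrame

theorem mem_orthogonal_span {S : Set R42} {v : R42} :
    v ∈ lieForm.orthogonal (Submodule.span ℝ S) ↔ ∀ s ∈ S, lieForm v s = 0 := by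
  rw [LinearMap.BilinForm.mem_orthogonal_iff]
  constructor
  · intro h s hs
    rw [lieForm_comm]
    exact h s (Submodule.subset_span hs)
  · intro h n hn
    induction hn using Submodule.span_induction with
    | mem x hx => exact (lieForm_comm x v).trans (h x hx)
    | zero => simp
    | add x y _ _ hx hy => simpa using by rw [hx, hy, add_zero]
    | smul c x _ hx => simpa using Or.inr hx

/-! ### The associated circle and the spheres orthogonal to it. -/

/-- The point sphere of `σ_a(F)`. -/
noncomputable def dualPoint (a p q r : R42) : R42 :=
  q - (2 / lieForm a a) • a + (2 * lieForm a p / lieForm a a) • r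

theorem lieInversion_mem {a p b v : R42} {F : Submodule ℝ R42}
    (hb : b ∈ Submodule.span ℝ {a, p})
    (hv : v ∈ F ⊔ Submodule.span ℝ {a, p}) :
    lieInversion b v ∈ F ⊔ Submodule.span ℝ {a, p} := by
  rw [lieInversion_apply]
  exact sub_mem hv (Submodule.mem_sup_right (Submodule.smul_mem _ _ hb))

theorem invert_le {a p b : R42} {F G : Submodule ℝ R42}
    (hb : b ∈ Submodule.span ℝ {a, p}) (hG : G ≤ F ⊔ Submodule.span ℝ {a, p}) :
    invert b G ≤ F ⊔ Submodule.span ℝ {a, p} := by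
  rintro _ ⟨v, hv, rfl⟩
  exact lieInversion_mem hb (hG hv)

theorem umbilicElement_le {a p b : R42} {F : Submodule ℝ R42}
    (hb : b ∈ Submodule.span ℝ {a, p}) :
    umbilicElement b F ≤ F ⊔ Submodule.span ℝ {a, p} := by
  apply sup_le
  · exact inf_le_left.trans le_sup_left
  · rw [Submodule.span_le]
    rintro _ rfl
    exact Submodule.mem_sup_right hb

namespace IsDualFrame

variable {a p q r : R42} {F : Submodule ℝ R42}

theorem isContactElement (h : IsDualFrame a p F q r) : IsContactElement F := by
  constructor
  · rw [h.eq_span]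
    apply finrank_span_pair
    intro α β h0
    have h1 := congrArg (fun w => lieForm w a) h0
    have h2 := congrArg (fun w => lieForm w p) h0
    simp only [map_add, map_smul, LinearMap.add_apply, LinearMap.smul_apply, smul_eq_mul, h.qa,
      h.qp, h.ra, h.rp, map_zero, LinearMap.zero_apply] at h1 h2
    constructor <;> linarith
  · intro s hs t ht
    obtain ⟨α, β, rfl⟩ := h.mem_iff.1 hs
    obtain ⟨γ, δ, rfl⟩ := h.mem_iff.1 ht
    simp [h.qq, h.rr, h.qr, h.rq]

theorem left_ne_zero (h : IsDualFrame a p F q r) : q ≠ 0 := by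
  rintro rfl
  simpa using h.qa

theorem dualPoint_p (h : IsDualFrame a p F q r) : lieForm (dualPoint a p q r) p = 0 := by
  simp only [dualPoint, map_add, map_sub, LinearMap.sub_apply, map_smul, LinearMap.add_apply,
      LinearMap.smul_apply, smul_eq_mul, h.qp, h.rp]
  ring

theorem dualPoint_q (h : IsDualFrame a p F q r) :
    lieForm q (dualPoint a p q r) = -(2 / lieForm a a) := by
  simp only [dualPoint, map_add, map_sub, map_smul, smul_eq_mul, h.qq, h.qa, h.qr]
  ring

theorem dualPoint_r (h : IsDualFrame a p F q r) :
    lieForm r (dualPoint a p q r) = 0 := by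
  simp only [dualPoint, map_add, map_sub, map_smul, smul_eq_mul, h.rr, h.ra, h.rq]
  ring

theorem dualPoint_self (h : IsDualFrame a p F q r) (ha : lieForm a a ≠ 0) :
    lieForm (dualPoint a p q r) (dualPoint a p q r) = 0 := by
  simp only [dualPoint, map_add, map_sub, LinearMap.sub_apply, map_smul, LinearMap.add_apply,
      LinearMap.smul_apply, smul_eq_mul, h.qq, h.rr, h.qr, h.rq, h.qa, h.ra, h.aq, h.ar]
  field_simp
  ring

theorem associatedCircle_eq (h : IsDualFrame a p F q r) (hp : lieForm p p = -1)
    (ha : lieForm a a ≠ 0) :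
    associatedCircle p F (invert a F) = Submodule.span ℝ {q, dualPoint a p q r, r + p} := by
  have h1 : pointSphere p F = Submodule.span ℝ {q} :=
    h.isContactElement.pointSphere_eq hp h.left_mem h.qp h.left_ne_zero
  have h2 : pointSphere p (invert a F) = Submodule.span ℝ {dualPoint a p q r} := by
    apply (h.isContactElement.invert ha).pointSphere_eq hp _ h.dualPoint_p
    · intro h0
      have := h.dualPoint_q
      rw [h0, map_zero, eq_comm, neg_eq_zero, div_eq_zero_iff] at this
      rcases this with h | h
      · norm_num at h
      · exact ha h
    · rw [mem_invert ha, h.mem_iff]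
      -- `σ_a` fixes `r`, so the points of `σ_a(F)` have the form `σ_a(q + c r)`; orthogonality to
      -- `p` fixes `c`.
      refine ⟨1, 2 * lieForm a p / lieForm a a, ?_⟩
      have h' : 2 * lieForm a a / lieForm a a = 2 := by field_simp
      simp only [dualPoint, map_add, map_sub, map_smul, lieInversion_apply, h.qa, h.ra, h']
      module
  have h3 : F ⊓ invert a F = Submodule.span ℝ {r} := by
    apply le_antisymm
    · rintro v ⟨hv, hv'⟩
      rw [SetLike.mem_coe, mem_invert ha, lieInversion_apply] at hv'
      -- The difference of `v` and its image is a multiple of `a`, and `⟨a, q⟩ = 1`; pairing with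
      -- `q` shows that this multiple is zero.
      have h0 := h.isContactElement.2 _ hv' _ h.left_mem
      have h4 := h.isContactElement.2 _ hv _ h.left_mem
      simp only [map_sub, map_smul, LinearMap.sub_apply, LinearMap.smul_apply, smul_eq_mul, h.aq,
        h4] at h0
      have h5 : lieForm v a = 0 := by
        field_simp at h0
        linarith
      rw [h.eq_combination hv, h5, zero_smul, zero_add]
      exact Submodule.smul_mem _ _ (Submodule.mem_span_singleton_self r)
    · rw [Submodule.span_le]
      rintro _ rfl
      refine ⟨h.right_mem, ?_⟩
      rw [SetLike.mem_coe, mem_invert ha, lieInversion_of_perp h.ra]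
      exact h.right_mem
  have h4 : pointProjection p r = r + p := by simp [pointProjection, h.rp]
  rw [associatedCircle, h1, h2, h3, Submodule.map_span, Set.image_singleton, h4,
    ← Submodule.span_union, ← Submodule.span_union, Set.union_assoc]
  rfl

theorem isCircle (h : IsDualFrame a p F q r) (hp : lieForm p p = -1)
    (ha : lieForm a a ≠ 0) : IsCircle p (associatedCircle p F (invert a F)) := by
  rw [h.associatedCircle_eq hp ha]
  have hd1 := h.dualPoint_p
  have hd2 := h.dualPoint_q
  have hd3 := h.dualPoint_r
  have hd4 := h.dualPoint_self ha
  generalize dualPoint a p q r = d at *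
  have hdq := lieForm_comm d q
  have hdr := lieForm_comm d r
  have hdp := lieForm_comm p d
  constructor
  -- The points `q` and `d` are null with product `-2/⟨a,a⟩`, so `q ∓ (⟨a,a⟩/4) d` have squares `±1`
  -- whatever the sign of `⟨a,a⟩`.
  · refine ⟨![r + p, q - (lieForm a a / 4) • d, q + (lieForm a a / 4) • d], ?_, ?_⟩
    · simp only [Matrix.range_cons, Matrix.range_empty, Set.union_empty, Set.singleton_union]
      apply le_antisymm <;> rw [Submodule.span_le]
      · rintro v (rfl | rfl | rfl) <;> rw [SetLike.mem_coe, Submodule.mem_span_triple]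
        · exact ⟨0, 1 / 2, 1 / 2, by module⟩
        · refine ⟨0, -(2 / lieForm a a), 2 / lieForm a a, ?_⟩
          rw [smul_sub, smul_add (2 / lieForm a a), smul_smul (-(2 / lieForm a a)), smul_smul (2 / lieForm a a)]
          have e1 : -(2 / lieForm a a) * (lieForm a a / 4) = -(1 / 2) := by field_simp; norm_num
          have e2 : 2 / lieForm a a * (lieForm a a / 4) = 1 / 2 := by field_simp; norm_num
          rw [e1, e2]
          module
        · exact ⟨1, 0, 0, by module⟩
      · rintro v (rfl | rfl | rfl) <;> rw [SetLike.mem_coe, Submodule.mem_span_triple]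
        · exact ⟨0, 0, 1, by module⟩
        · exact ⟨1, -(lieForm a a / 4), 0, by module⟩
        · exact ⟨1, lieForm a a / 4, 0, by module⟩
    · intro i j
      fin_cases i <;> fin_cases j <;>
      · simp [hd1, hd2, hd3, hd4, hdq, hdr, hdp, h.qq, h.rr, h.qr, h.rq, h.qp, h.pq, h.rp, h.pr, hp]
        try (field_simp; norm_num)
  · rw [Submodule.span_le]
    rintro v (rfl | rfl | rfl) <;> rw [SetLike.mem_coe, mem_perp]
    · exact h.qp
    · exact hd1
    · simp [h.rp, hp]

/-- The orthogonal complement of `F ⊔ span(a, p)` is positive definite. -/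
theorem pos_of_perp (h : IsDualFrame a p F q r) (hp : lieForm p p = -1) (ha : lieForm a a ≠ 0)
    {w : R42} (hw : w ≠ 0) (h1 : lieForm w q = 0) (h2 : lieForm w r = 0) (h3 : lieForm w a = 0)
    (h4 : lieForm w p = 0) : 0 < lieForm w w := by
  by_contra! hn
  have hd1 := h.dualPoint_p
  have hd2 := h.dualPoint_q
  have hd4 := h.dualPoint_self ha
  have hd5 : lieForm w (dualPoint a p q r) = 0 := by
    simp [dualPoint, h1, h2, h3]
  generalize dualPoint a p q r = d at *
  have hdq := lieForm_comm d q
  have hdp := lieForm_comm p d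
  have hdw := lieForm_comm d w
  have hqw := lieForm_comm q w
  have hpw := lieForm_comm p w
  set e := q + (lieForm a a / 4) • d with he
  have hep : lieForm e p = 0 := by simp [he, h.qp, hd1]
  have hpe : lieForm p e = 0 := (lieForm_comm p e).trans hep
  have hwe : lieForm w e = 0 := by simp [he, h1, hd5]
  have hew : lieForm e w = 0 := (lieForm_comm e w).trans hwe
  have hee : lieForm e e = -1 := by
    simp [he, h.qq, hd2, hdq, hd4]
    field_simp
    norm_num
  have hQ (α β γ : ℝ) : lieForm (α • p + β • e + γ • w) (α • p + β • e + γ • w) =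
      -α ^ 2 - β ^ 2 + γ ^ 2 * lieForm w w := by
    simp only [map_add, map_smul, LinearMap.add_apply, LinearMap.smul_apply, smul_eq_mul, hp, hep,
      hpe, hwe, hew, hee, h4, hpw]
    ring
  -- `p` and `e` span a negative definite plane orthogonal to `w`. If `⟨w,w⟩ ≤ 0`, adjoining `w`
  -- would give a negative semidefinite three-space.
  obtain ⟨α, β, γ, hne, h0⟩ := exists_combination_eq_zero p e w (fun α β γ => by
    rw [hQ]; nlinarith [sq_nonneg α, sq_nonneg β, sq_nonneg γ])
  have hα := congrArg (fun w => lieForm w p) h0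
  have hβ := congrArg (fun w => lieForm w e) h0
  simp only [map_add, map_smul, LinearMap.add_apply, LinearMap.smul_apply, smul_eq_mul, hp, hep,
      hpe, hwe, hee, h4, map_zero, LinearMap.zero_apply] at hα hβ
  obtain rfl : α = 0 := by linarith
  obtain rfl : β = 0 := by linarith
  simp only [zero_smul, zero_add, smul_eq_zero, hw, or_false] at h0
  simp [h0] at hne

/-- The passage from spheres to all vectors rests on definiteness: each `w` orthogonal to the
four-space has a square root `k` of `⟨w,w⟩`, which makes `w + k p` a sphere of the complement of the
circle. -/
theorem circleOrthogonal_iff (h : IsDualFrame a p F q r) (hp : lieForm p p = -1)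
    (ha : lieForm a a ≠ 0) {s : R42} :
    CircleOrthogonal p (associatedCircle p F (invert a F)) s ↔
      s ∈ F ⊔ Submodule.span ℝ {a, p} := by
  rw [h.associatedCircle_eq hp ha]
  unfold CircleOrthogonal SpheresOrthogonal
  simp only [mem_orthogonal_span, Set.mem_insert_iff, Set.mem_singleton_iff, forall_eq_or_imp,
    forall_eq]
  constructor
  · intro H
    obtain ⟨u, hu, h1, h2, h3, h4⟩ := h.exists_sub_perp hp s
    obtain ⟨w, rfl⟩ : ∃ w, s = u + w := ⟨s - u, by abel⟩
    rw [add_sub_cancel_left] at h1 h2 h3 h4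
    suffices w = 0 by simpa [this] using hu
    by_contra hw
    have hpos := h.pos_of_perp hp ha hw h1 h2 h3 h4
    have hsq := Real.mul_self_sqrt hpos.le
    have hs0 := (Real.sqrt_pos.2 hpos).ne'
    have huw := h.lieForm_eq_zero_of_mem hu h1 h2 h3 h4
    set k := Real.sqrt (lieForm w w)
    have hpw := lieForm_comm p w
    -- This vector is null because `⟨p,p⟩ = -1`, and adding its product with `p` times `p` leaves
    -- exactly `w`. Orthogonality to `u + w` then reads `⟨w,w⟩ = 0`.
    have := H (w + k • p) ?_ ⟨?_, ?_⟩
    · have e : w + k • p + lieForm (w + k • p) p • p = w := by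
        simp [h4, hp]
      rw [e] at this
      simp [huw] at this
      exact hpos.ne' this
    · simp [dualPoint, h1, h2, h3, h4, h.pq, h.pr, hp, lieForm_comm p a]
      right
      ring
    · intro h0
      have := congrArg (fun w => lieForm w p) h0
      simp [h4, hp, hs0] at this
    · simp [hpw, h4, hp, hsq]
  · rintro hs v ⟨h1, h2, h3⟩ -
    have hr : lieForm v r + lieForm v p = 0 := by simpa using h3
    -- `v + ⟨v,p⟩ p` is orthogonal to all of `q`, `r`, `a`, `p`; the product with `a` is controlled
    -- by the second point sphere.
    apply h.lieForm_eq_zero_of_mem hs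
    · simp [h1, h.pq]
    · simp [h.pr, hr]
    · simp only [dualPoint, map_add, map_sub, map_smul, smul_eq_mul, h1] at h2
      have h4 : lieForm v a = lieForm a p * lieForm v r := by
        field_simp at h2
        linarith
      simp only [map_add, map_smul, LinearMap.add_apply, LinearMap.smul_apply, smul_eq_mul, h4,
        lieForm_comm p a]
      linear_combination lieForm a p * hr
    · simp [hp]

/-! ### Classification of the null planes in the four-space. -/

/-- A vector of `F` orthogonal to `k a + l p`. -/
theorem perp_combination (h : IsDualFrame a p F q r) (k l : ℝ) :
    lieForm (l • q - k • r) (k • a + l • p) = 0 := by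
  simp [h.qa, h.qp, h.ra, h.rp]
  ring

theorem exists_eq_smul (h : IsDualFrame a p F q r) {k l : ℝ}
    (hb : k ≠ 0 ∨ l ≠ 0) {v : R42} (hv : v ∈ F) (h0 : lieForm v (k • a + l • p) = 0) :
    ∃ c : ℝ, v = c • (l • q - k • r) := by
  obtain ⟨α, β, rfl⟩ := h.mem_iff.1 hv
  have h0 : α * k + β * l = 0 := by
    simp [h.qa, h.qp, h.ra, h.rp] at h0
    linarith
  rcases hb with hk | hl
  · refine ⟨-(β / k), ?_⟩
    have : α = -(β / k) * l := by field_simp; linarith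
    rw [this]
    match_scalars <;> field_simp
  · refine ⟨α / l, ?_⟩
    have : β = -(α / l) * k := by field_simp; linarith
    rw [this]
    match_scalars <;> field_simp

theorem umbilicElement_eq (h : IsDualFrame a p F q r) {k l : ℝ} (hb : k ≠ 0 ∨ l ≠ 0) :
    umbilicElement (k • a + l • p) F =
      Submodule.span ℝ {l • q - k • r, k • a + l • p} := by
  have : F ⊓ perp (k • a + l • p) = Submodule.span ℝ {l • q - k • r} := by
    ext v
    rw [Submodule.mem_inf, mem_perp, Submodule.mem_span_singleton]
    constructor
    · rintro ⟨hv, h0⟩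
      obtain ⟨c, rfl⟩ := h.exists_eq_smul hb hv h0
      exact ⟨c, rfl⟩
    · rintro ⟨c, rfl⟩
      refine ⟨F.smul_mem _ (F.sub_mem (F.smul_mem _ h.left_mem) (F.smul_mem _ h.right_mem)), ?_⟩
      rw [map_smul, LinearMap.smul_apply, h.perp_combination, smul_zero]
  rw [umbilicElement, this, ← Submodule.span_union]
  rfl

theorem isContactElement_umbilicElement (h : IsDualFrame a p F q r) {k l : ℝ}
    (hb : IsSphere (k • a + l • p)) : IsContactElement (umbilicElement (k • a + l • p) F) := by
  have hkl : k ≠ 0 ∨ l ≠ 0 := by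
    by_contra! h0
    exact hb.1 (by simp [h0.1, h0.2])
  rw [h.umbilicElement_eq hkl]
  have h1 := h.perp_combination k l
  have h2 : lieForm (l • q - k • r) (l • q - k • r) = 0 := by
    simp [h.qq, h.rr, h.qr, h.rq]
  constructor
  · apply finrank_span_pair
    intro α β h0
    have e1 := congrArg (fun w => lieForm w q) h0
    have e2 := congrArg (fun w => lieForm w r) h0
    simp [h.qq, h.rr, h.qr, h.rq, h.aq, h.ar, h.pq, h.pr] at e1 e2
    have hβ : β = 0 := by
      rcases hkl with hk | hl
      · exact e1.resolve_right hk
      · exact e2.resolve_right hl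
    subst hβ
    have e1 := congrArg (fun w => lieForm w a) h0
    have e2 := congrArg (fun w => lieForm w p) h0
    simp [h.qa, h.ra, h.qp, h.rp] at e1 e2
    refine ⟨?_, rfl⟩
    rcases hkl with hk | hl
    · exact e2.resolve_right hk
    · exact e1.resolve_right hl
  · intro s hs t ht
    obtain ⟨α, β, rfl⟩ := Submodule.mem_span_pair.1 hs
    obtain ⟨γ, δ, rfl⟩ := Submodule.mem_span_pair.1 ht
    have h3 := lieForm_comm (k • a + l • p) (l • q - k • r)
    have hbb := hb.2
    generalize k • a + l • p = b at *
    generalize l • q - k • r = w at *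
    simp [h1, h2, h3, hbb]

/-- A non-null vector of `span(a, p)` is determined up to scale by the image of `F`. -/
theorem span_eq_of_invert_eq (h : IsDualFrame a p F q r) {b b' : R42}
    (hb : b ∈ nonnullSpan a p) (hb' : b' ∈ nonnullSpan a p) (he : invert b F = invert b' F) :
    Submodule.span ℝ {b} = Submodule.span ℝ {b'} := by
  obtain ⟨hb, hb0⟩ := hb
  obtain ⟨hb', hb0'⟩ := hb'
  obtain ⟨k, l, rfl⟩ := Submodule.mem_span_pair.1 hb
  obtain ⟨k', l', rfl⟩ := Submodule.mem_span_pair.1 hb'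
  have hw := h.perp_combination k l
  have hwF : l • q - k • r ∈ F :=
    F.sub_mem (F.smul_mem _ h.left_mem) (F.smul_mem _ h.right_mem)
  -- The vector of `F` orthogonal to `b` is fixed by `σ_b`, so `σ_b'` also keeps it in `F`. As no
  -- nonzero multiple of `b'` lies in `F`, it is orthogonal to `b'` too, which makes the
  -- coefficients of `b` and `b'` proportional.
  have hmem : l • q - k • r ∈ invert (k • a + l • p) F := by
    rw [mem_invert hb0, lieInversion_of_perp hw]
    exact hwF
  rw [he, mem_invert hb0', lieInversion_apply] at hmem
  set m := 2 * lieForm (l • q - k • r) (k' • a + l' • p) /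
    lieForm (k' • a + l' • p) (k' • a + l' • p) with hm
  have hkl' : k' ≠ 0 ∨ l' ≠ 0 := by
    by_contra! h0
    exact hb0' (by simp [h0.1, h0.2])
  have e1 := h.isContactElement.2 _ hmem _ h.left_mem
  have e2 := h.isContactElement.2 _ hmem _ h.right_mem
  simp [h.qq, h.rr, h.qr, h.rq, h.aq, h.ar, h.pq, h.pr] at e1 e2
  have hm0 : m = 0 := by
    rcases hkl' with hk | hl
    · exact e1.resolve_right hk
    · exact e2.resolve_right hl
  have hdet : l * k' - k * l' = 0 := by
    rw [hm0, eq_comm, div_eq_zero_iff] at hm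
    have := hm.resolve_right hb0'
    simp [h.qa, h.qp, h.ra, h.rp] at this
    linarith
  have hkl : k ≠ 0 ∨ l ≠ 0 := by
    by_contra! h0
    exact hb0 (by simp [h0.1, h0.2])
  obtain ⟨c, hc0, hck, hcl⟩ : ∃ c : ℝ, c ≠ 0 ∧ k = c * k' ∧ l = c * l' := by
    rcases hkl' with hk' | hl'
    · refine ⟨k / k', ?_, by field_simp, by field_simp; linarith⟩
      rintro h0
      have hk : k = 0 := (div_eq_zero_iff.1 h0).resolve_right hk'
      subst hk
      have : l = 0 := by simpa [hk'] using hdet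
      simp [this] at hkl
    · refine ⟨l / l', ?_, by field_simp; linarith, by field_simp⟩
      rintro h0
      have hl : l = 0 := (div_eq_zero_iff.1 h0).resolve_right hl'
      subst hl
      have : k = 0 := by simpa [hl'] using hdet
      simp [this] at hkl
  have : k • a + l • p = c • (k' • a + l' • p) := by
    rw [hck, hcl]; module
  rw [this]
  exact Submodule.span_singleton_smul_eq (IsUnit.mk0 c hc0) _

end IsDualFrame
namespace IsDualFrame

variable {a p q r : R42} {F : Submodule ℝ R42}

theorem combination_ne_zero (h : IsDualFrame a p F q r) {k l : ℝ} (hkl : k ≠ 0 ∨ l ≠ 0) :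
    k • a + l • p ≠ 0 := by
  intro h0
  have e1 := congrArg (fun w => lieForm w q) h0
  have e2 := congrArg (fun w => lieForm w r) h0
  simp [h.aq, h.ar, h.pq, h.pr] at e1 e2
  exact hkl.elim (· e1) (· e2)

/-- A null plane in `F ⊔ span(a, p)` that meets `F` in a line is the image of `F` under a Lie
inversion or is umbilic. -/
theorem exists_eq_of_meet (h : IsDualFrame a p F q r) {G : Submodule ℝ R42}
    (hG : IsContactElement G) (hGW : G ≤ F ⊔ Submodule.span ℝ {a, p}) (hne : G ≠ F)
    {u : R42} (hu : u ∈ F) (huG : u ∈ G) (hu0 : u ≠ 0) :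
    (∃ b ∈ nonnullSpan a p, G = invert b F) ∨ ∃ b ∈ nullSpan a p, G = umbilicElement b F := by
  obtain ⟨v, hv, hvF⟩ : ∃ v ∈ G, v ∉ F := by
    by_contra! hle
    exact hne (Submodule.eq_of_le_of_finrank_eq hle (hG.1.trans h.isContactElement.1.symm))
  obtain ⟨α, β, k, l, hv'⟩ := h.mem_sup_iff.1 (hGW hv)
  have hw : α • q + β • r ∈ F := h.mem_iff.2 ⟨α, β, rfl⟩
  have hvb : v = (α • q + β • r) + (k • a + l • p) := by rw [hv']; module
  generalize α • q + β • r = w at *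
  have hkl : k ≠ 0 ∨ l ≠ 0 := by
    by_contra! h0
    rw [h0.1, h0.2, zero_smul, zero_smul, add_zero, add_zero] at hvb
    exact hvF (hvb ▸ hw)
  have hub : lieForm u (k • a + l • p) = 0 := by
    have h1 := hG.2 u huG v hv
    rwa [hvb, map_add, h.isContactElement.2 u hu w hw, zero_add] at h1
  have hbmem : k • a + l • p ∈ Submodule.span ℝ {a, p} := Submodule.mem_span_pair.2 ⟨k, l, rfl⟩
  have hb0 := h.combination_ne_zero hkl
  have hvv := hG.2 v hv v hv
  rw [hvb] at hvv
  have hwb := lieForm_comm (k • a + l • p) w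
  rw [map_add, map_add, LinearMap.add_apply, LinearMap.add_apply, hwb,
    h.isContactElement.2 w hw w hw] at hvv
  have hspan : G = Submodule.span ℝ {u, v} := by
    apply hG.eq_span huG hv
    intro x y hxy
    have hy : y = 0 := by
      by_contra hy
      apply hvF
      have : v = (-(y⁻¹ * x)) • u := by
        have : y⁻¹ • (x • u + y • v) = 0 := by rw [hxy, smul_zero]
        rw [smul_add, smul_smul, smul_smul, inv_mul_cancel₀ hy, one_smul] at this
        rw [neg_smul]
        exact eq_neg_of_add_eq_zero_right this
      rw [this]
      exact F.smul_mem _ hu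
    subst hy
    simpa [hu0] using hxy
  -- Write `b` for the `span(a, p)` part of `v = w + b`. Nullity of `v` reads `2⟨w,b⟩ + ⟨b,b⟩ = 0`:
  -- for null `b` it puts `w` in `b^⊥`, otherwise it says `σ_b(w) = w + b = v`. In both cases `u` is
  -- orthogonal to `b`.
  by_cases hbb : lieForm (k • a + l • p) (k • a + l • p) = 0
  · right
    refine ⟨_, ⟨hbmem, hb0, hbb⟩, ?_⟩
    apply Submodule.eq_of_le_of_finrank_eq _
      (hG.1.trans (h.isContactElement_umbilicElement ⟨hb0, hbb⟩).1.symm)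
    rw [hspan, Submodule.span_le]
    rintro _ (rfl | rfl)
    · exact Submodule.mem_sup_left ⟨hu, mem_perp.2 hub⟩
    · rw [hvb]
      refine add_mem (Submodule.mem_sup_left ⟨hw, mem_perp.2 ?_⟩)
        (Submodule.mem_sup_right (Submodule.mem_span_singleton_self _))
      linarith
  · left
    refine ⟨_, ⟨hbmem, hbb⟩, ?_⟩
    apply Submodule.eq_of_le_of_finrank_eq _
      (hG.1.trans (h.isContactElement.invert hbb).1.symm)
    rw [hspan, Submodule.span_le]
    rintro _ (rfl | rfl)
    · exact ⟨_, hu, lieInversion_of_perp hub⟩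
    · refine ⟨w, hw, ?_⟩
      have : 2 * lieForm w (k • a + l • p) / lieForm (k • a + l • p) (k • a + l • p) = -1 := by
        rw [div_eq_iff hbb]
        linarith
      rw [lieInversion_apply, this, hvb]
      module

/-- A null plane that meets `F` trivially belongs to the other family of null planes than those
meeting `F` in a line. The reflection `σ_p` moves it to a plane that meets `F`. -/
theorem exists_eq_of_le (h : IsDualFrame a p F q r) (hp : lieForm p p = -1) {G : Submodule ℝ R42}
    (hG : IsContactElement G) (hGW : G ≤ F ⊔ Submodule.span ℝ {a, p}) :
    (∃ b ∈ nonnullSpan a p, G = invert b F ∨ G = invert p (invert b F)) ∨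
      ∃ b ∈ nullSpan a p, G = umbilicElement b F ∨ G = invert p (umbilicElement b F) := by
  have hp0 : lieForm p p ≠ 0 := by rw [hp]; norm_num
  have hpmem : p ∈ Submodule.span ℝ {a, p} := Submodule.mem_span_pair.2 ⟨0, 1, by simp⟩
  by_cases hGF : G = F
  -- `F` itself arises only with the orientation change, as `σ_p(σ_p(F))`.
  · exact Or.inl ⟨p, ⟨hpmem, hp0⟩, Or.inr (by rw [invert_invert hp0, hGF])⟩
  by_cases hmeet : ∃ u ∈ F, u ∈ G ∧ u ≠ 0
  · obtain ⟨u, hu, huG, hu0⟩ := hmeet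
    exact (h.exists_eq_of_meet hG hGW hGF hu huG hu0).imp
      (fun ⟨b, hb, e⟩ => ⟨b, hb, Or.inl e⟩) (fun ⟨b, hb, e⟩ => ⟨b, hb, Or.inl e⟩)
  push Not at hmeet
  let T : G →ₗ[ℝ] (Fin 2 → ℝ) :=
    LinearMap.pi ![(lieForm.flip q).comp G.subtype, (lieForm.flip r).comp G.subtype]
  have hT : Function.Injective T := by
    rw [← LinearMap.ker_eq_bot, LinearMap.ker_eq_bot']
    rintro ⟨u, hu⟩ hu0
    have h0 : lieForm u q = 0 := by simpa [T] using congrFun hu0 0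
    have h1 : lieForm u r = 0 := by simpa [T] using congrFun hu0 1
    obtain ⟨α, β, k, l, rfl⟩ := h.mem_sup_iff.1 (hGW hu)
    simp [h.qq, h.rr, h.qr, h.rq, h.aq, h.ar, h.pq, h.pr] at h0 h1
    exact Subtype.ext (hmeet _ (h.mem_iff.2 ⟨α, β, by simp [h0, h1]⟩) hu)
  -- `G` pairs perfectly with `F`. The prescribed products make the `span(a, p)` part of `v` equal
  -- to `p`; nullity then gives the coefficient `1/2` of `r`, for which `σ_p(v) = v - p` lies in
  -- `F`.
  obtain ⟨⟨v, hv⟩, hv'⟩ :=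
    (LinearMap.injective_iff_surjective_of_finrank_eq_finrank (by simp [hG.1])).1 hT ![0, 1]
  have h0 : lieForm v q = 0 := by simpa [T] using congrFun hv' 0
  have h1 : lieForm v r = 1 := by simpa [T] using congrFun hv' 1
  have hvv := hG.2 v hv v hv
  have hσ : lieInversion p v ∈ invert p G := ⟨v, hv, rfl⟩
  obtain ⟨α, β, k, l, rfl⟩ := h.mem_sup_iff.1 (hGW hv)
  simp [h.qq, h.rr, h.qr, h.rq, h.aq, h.ar, h.pq, h.pr] at h0 h1
  subst h0 h1
  obtain rfl : β = 1 / 2 := by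
    simp [h.qq, h.rr, h.qr, h.rq, h.pq, h.pr, h.qp, h.rp, hp] at hvv
    linarith
  have e : lieInversion p (α • q + (1 / 2 : ℝ) • r + (0 : ℝ) • a + (1 : ℝ) • p) =
      α • q + (1 / 2 : ℝ) • r := by
    rw [lieInversion_apply]
    simp only [map_add, map_smul, LinearMap.add_apply, LinearMap.smul_apply, smul_eq_mul, hp, h.qp,
      h.rp]
    module
  rw [e] at hσ
  have hGF' : invert p G ≠ F := by
    intro h0
    apply h.left_ne_zero
    apply hmeet q h.left_mem
    rw [← invert_invert hp0 G, h0, mem_invert hp0, lieInversion_of_perp h.qp]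
    exact h.left_mem
  have hu0 : α • q + (1 / 2 : ℝ) • r ≠ 0 := by
    intro h0
    have := congrArg (fun w => lieForm w p) h0
    simp [h.qp, h.rp] at this
  have := h.exists_eq_of_meet (hG.invert hp0) (invert_le hpmem hGW) hGF'
    (h.mem_iff.2 ⟨_, _, rfl⟩) hσ hu0
  refine this.imp (fun ⟨b, hb, e⟩ => ⟨b, hb, Or.inr ?_⟩) (fun ⟨b, hb, e⟩ => ⟨b, hb, Or.inr ?_⟩) <;>
  rw [← e, invert_invert hp0]

/-- Null planes in `F ⊔ span(a, p)` are maximal null subspaces. -/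
theorem mem_of_perp (h : IsDualFrame a p F q r) (hp : lieForm p p = -1) {G : Submodule ℝ R42}
    (hG : IsContactElement G) (hGW : G ≤ F ⊔ Submodule.span ℝ {a, p}) {w : R42}
    (hw : w ∈ F ⊔ Submodule.span ℝ {a, p}) (hwG : ∀ s ∈ G, lieForm w s = 0) : w ∈ G := by
  have hp0 : lieForm p p ≠ 0 := by rw [hp]; norm_num
  have hpmem : p ∈ Submodule.span ℝ {a, p} := Submodule.mem_span_pair.2 ⟨0, 1, by simp⟩
  have hF {w : R42} (hw : w ∈ F ⊔ Submodule.span ℝ {a, p}) (hwG : ∀ s ∈ F, lieForm w s = 0) :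
      w ∈ F := by
    have h0 := hwG q h.left_mem
    have h1 := hwG r h.right_mem
    obtain ⟨α, β, k, l, rfl⟩ := h.mem_sup_iff.1 hw
    simp [h.qq, h.rr, h.qr, h.rq, h.aq, h.ar, h.pq, h.pr] at h0 h1
    exact h.mem_iff.2 ⟨α, β, by simp [h0, h1]⟩
  -- Maximality is clear for `F`, is carried along by inversions and is checked directly for umbilic
  -- elements; the classification reduces every `G` to these cases.
  have hinv {b : R42} (hb : b ∈ Submodule.span ℝ {a, p}) (hb0 : lieForm b b ≠ 0)
      {G : Submodule ℝ R42} (H : ∀ w ∈ F ⊔ Submodule.span ℝ {a, p},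
        (∀ s ∈ G, lieForm w s = 0) → w ∈ G) (w : R42) (hw : w ∈ F ⊔ Submodule.span ℝ {a, p})
      (hwG : ∀ s ∈ invert b G, lieForm w s = 0) : w ∈ invert b G := by
    rw [mem_invert hb0]
    refine H _ (lieInversion_mem hb hw) fun s hs => ?_
    rw [← lieForm_lieInversion hb0, lieInversion_lieInversion hb0]
    exact hwG _ ⟨s, hs, rfl⟩
  have humb {b : R42} (hb : b ∈ nullSpan a p) (w : R42)
      (hw : w ∈ F ⊔ Submodule.span ℝ {a, p})
      (hwG : ∀ s ∈ umbilicElement b F, lieForm w s = 0) : w ∈ umbilicElement b F := by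
    obtain ⟨hb, hb0, hbb⟩ := hb
    obtain ⟨k, l, rfl⟩ := Submodule.mem_span_pair.1 hb
    have hkl : k ≠ 0 ∨ l ≠ 0 := by
      by_contra! h0
      exact hb0 (by simp [h0.1, h0.2])
    have h1 := hwG (l • q - k • r) (by
      rw [h.umbilicElement_eq hkl]; exact Submodule.subset_span (by simp))
    have h2 := hwG _ (Submodule.mem_sup_right (Submodule.mem_span_singleton_self _))
    obtain ⟨α, β, k', l', rfl⟩ := h.mem_sup_iff.1 hw
    have hc : ∃ c : ℝ, k' = c * k ∧ l' = c * l := by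
      simp [h.qq, h.rr, h.qr, h.rq, h.aq, h.ar, h.pq, h.pr] at h1
      rcases hkl with hk | hl
      · exact ⟨k' / k, by field_simp, by field_simp; linarith⟩
      · exact ⟨l' / l, by field_simp; linarith, by field_simp⟩
    obtain ⟨c, rfl, rfl⟩ := hc
    have e : α • q + β • r + (c * k) • a + (c * l) • p =
        (α • q + β • r) + c • (k • a + l • p) := by module
    rw [e] at h2 ⊢
    refine add_mem (Submodule.mem_sup_left ⟨h.mem_iff.2 ⟨_, _, rfl⟩, mem_perp.2 ?_⟩)
      (Submodule.mem_sup_right (Submodule.smul_mem _ _ (Submodule.mem_span_singleton_self _)))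
    generalize k • a + l • p = b at *
    simpa [hbb] using h2
  rcases h.exists_eq_of_le hp hG hGW with ⟨b, hb, rfl | rfl⟩ | ⟨b, hb, rfl | rfl⟩
  · exact hinv hb.1 hb.2 (fun w => hF) w hw hwG
  · exact hinv hpmem hp0 (hinv hb.1 hb.2 (fun w => hF)) w hw hwG
  · exact humb hb w hw hwG
  · exact hinv hpmem hp0 (humb hb) w hw hwG

end IsDualFrame

/-! ### Coordinates with respect to the frame. -/

/-- The products of a vector with the frame `q`, `r`, `a`, `p`. -/
noncomputable def pairing (a p q r : R42) : R42 →ₗ[ℝ] (Fin 4 → ℝ) :=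
  LinearMap.pi ![lieForm.flip q, lieForm.flip r, lieForm.flip a, lieForm.flip p]

theorem pairing_apply (a p q r v : R42) :
    pairing a p q r v = ![lieForm v q, lieForm v r, lieForm v a, lieForm v p] := by
  ext i
  fin_cases i <;> simp [pairing]

theorem pairing_eq_zero {a p q r v : R42} : pairing a p q r v = 0 ↔
    lieForm v q = 0 ∧ lieForm v r = 0 ∧ lieForm v a = 0 ∧ lieForm v p = 0 := by
  rw [pairing_apply, funext_iff]
  simp [Fin.forall_fin_succ]

namespace IsDualFrame

variable {a p q r : R42} {F : Submodule ℝ R42}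

theorem eq_of_map_pairing_eq (h : IsDualFrame a p F q r) (hp : lieForm p p = -1)
    {G H : Submodule ℝ R42} (hG : G ≤ F ⊔ Submodule.span ℝ {a, p})
    (hH : H ≤ F ⊔ Submodule.span ℝ {a, p})
    (he : G.map (pairing a p q r) = H.map (pairing a p q r)) : G = H := by
  have key {G H : Submodule ℝ R42} (hG : G ≤ F ⊔ Submodule.span ℝ {a, p})
      (hH : H ≤ F ⊔ Submodule.span ℝ {a, p})
      (he : G.map (pairing a p q r) = H.map (pairing a p q r)) : G ≤ H := by
    intro v hv
    obtain ⟨w, hw, hvw⟩ := he ▸ Submodule.mem_map_of_mem (f := pairing a p q r) hv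
    have h0 : pairing a p q r (v - w) = 0 := by rw [map_sub, hvw, sub_self]
    obtain ⟨h1, h2, h3, h4⟩ := pairing_eq_zero.1 h0
    have := h.eq_zero_of_mem hp (sub_mem (hG hv) (hH hw)) h1 h2 h3 h4
    rwa [sub_eq_zero.1 this]
  exact le_antisymm (key hG hH he) (key hH hG he.symm)

/-- Pairing cannot distinguish `d` from its projection to the four-space. That projection is still
orthogonal to `G`, hence lies in `G` by maximality. -/
theorem pairing_mem (h : IsDualFrame a p F q r) (hp : lieForm p p = -1) {G : Submodule ℝ R42}
    (hG : IsContactElement G) (hGW : G ≤ F ⊔ Submodule.span ℝ {a, p}) {d : R42}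
    (hd : ∀ s ∈ G, lieForm s d = 0) : pairing a p q r d ∈ G.map (pairing a p q r) := by
  obtain ⟨w, hw, h1, h2, h3, h4⟩ := h.exists_sub_perp hp d
  refine ⟨w, h.mem_of_perp hp hG hGW hw fun s hs => ?_, ?_⟩
  · have h5 := h.lieForm_eq_zero_of_mem (hGW hs) h1 h2 h3 h4
    rw [map_sub, hd s hs, zero_sub, neg_eq_zero] at h5
    rwa [lieForm_comm]
  · have := pairing_eq_zero.2 ⟨h1, h2, h3, h4⟩
    rw [map_sub] at this
    exact (sub_eq_zero.1 this).symm

end IsDualFrame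

/-! ### Constancy of parallel plane fields. -/

/-- A plane field with a frame whose derivatives lie in the plane is locally constant. -/
theorem eventually_span_eq {V E : Type*} [NormedAddCommGroup V] [NormedSpace ℝ V]
    [NormedAddCommGroup E] [NormedSpace ℝ E] [FiniteDimensional ℝ E] {σ τ : V → E} {U : Set V}
    (hU : IsOpen U) {x : V} (hx : x ∈ U) (hσ : ∀ y ∈ U, DifferentiableAt ℝ σ y)
    (hτ : ∀ y ∈ U, DifferentiableAt ℝ τ y)
    (hli : LinearIndependent ℝ ![σ x, τ x])
    (hσ' : ∀ y ∈ U, ∀ X, fderiv ℝ σ y X ∈ Submodule.span ℝ {σ y, τ y})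
    (hτ' : ∀ y ∈ U, ∀ X, fderiv ℝ τ y X ∈ Submodule.span ℝ {σ y, τ y}) :
    ∀ᶠ y in nhds x, Submodule.span ℝ {σ y, τ y} = Submodule.span ℝ {σ x, τ x} := by
  obtain ⟨g, hg⟩ := LinearMap.exists_leftInverse_of_injective
    (Fintype.linearCombination ℝ ![σ x, τ x]) (LinearMap.ker_eq_bot.2
      (linearIndependent_iff_injective_fintypeLinearCombination.1 hli))
  have hg0 : g (σ x) = ![1, 0] := by
    have := LinearMap.congr_fun hg ![1, 0]
    simpa [Fintype.linearCombination_apply] using this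
  have hg1 : g (τ x) = ![0, 1] := by
    have := LinearMap.congr_fun hg ![0, 1]
    simpa [Fintype.linearCombination_apply] using this
  -- `A` and `B` are functionals dual to `σ x`, `τ x`. Where the determinant `D` is nonzero they
  -- serve as coordinates on the plane at `y`.
  let A : E →L[ℝ] ℝ := LinearMap.toContinuousLinearMap ((LinearMap.proj 0).comp g)
  let B : E →L[ℝ] ℝ := LinearMap.toContinuousLinearMap ((LinearMap.proj 1).comp g)
  have hA0 : A (σ x) = 1 := by simp [A, hg0]
  have hA1 : A (τ x) = 0 := by simp [A, hg1]
  have hB0 : B (σ x) = 0 := by simp [B, hg0]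
  have hB1 : B (τ x) = 1 := by simp [B, hg1]
  clear_value A B
  let D : V → ℝ := fun y => A (σ y) * B (τ y) - A (τ y) * B (σ y)
  have hA (y) (hy : y ∈ U) : DifferentiableAt ℝ (fun y => A (σ y)) y :=
    A.differentiableAt.comp y (hσ y hy)
  have hA' (y) (hy : y ∈ U) : DifferentiableAt ℝ (fun y => A (τ y)) y :=
    A.differentiableAt.comp y (hτ y hy)
  have hB (y) (hy : y ∈ U) : DifferentiableAt ℝ (fun y => B (σ y)) y :=
    B.differentiableAt.comp y (hσ y hy)
  have hB' (y) (hy : y ∈ U) : DifferentiableAt ℝ (fun y => B (τ y)) y :=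
    B.differentiableAt.comp y (hτ y hy)
  have hD (y) (hy : y ∈ U) : DifferentiableAt ℝ D y :=
    ((hA y hy).mul (hB' y hy)).sub ((hA' y hy).mul (hB y hy))
  have hDx : D x ≠ 0 := by simp [D, hA0, hA1, hB0, hB1]
  obtain ⟨ε, hε, hball⟩ := Metric.eventually_nhds_iff_ball.1
    (((hD x hx).continuousAt.eventually_ne hDx).and (hU.mem_nhds hx))
  -- By Cramer's rule, the vector of the plane at `y` with coordinates `A = k`, `B = l`. Its
  -- derivative lies in the plane and has both coordinates zero, so `S k l` is constant on the ball.
  let S : ℝ → ℝ → V → E := fun k l y =>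
    ((k * B (τ y) - l * A (τ y)) / D y) • σ y + ((l * A (σ y) - k * B (σ y)) / D y) • τ y
  have hS (k l : ℝ) {y : V} (hy : y ∈ Metric.ball x ε) : S k l y = S k l x := by
    have hdiff (y) (hy : y ∈ Metric.ball x ε) : ∃ c₁ c₂ : V → ℝ, S k l = (fun y => c₁ y • σ y +
        c₂ y • τ y) ∧ DifferentiableAt ℝ c₁ y ∧ DifferentiableAt ℝ c₂ y := by
      obtain ⟨hDy, hyU⟩ := hball y hy
      refine ⟨_, _, rfl, ?_, ?_⟩
      · exact (((hB' y hyU).const_mul k).sub ((hA' y hyU).const_mul l)).mul ((hD y hyU).inv hDy)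
      · exact (((hA y hyU).const_mul l).sub ((hB y hyU).const_mul k)).mul ((hD y hyU).inv hDy)
    have hdiffS (y) (hy : y ∈ Metric.ball x ε) : DifferentiableAt ℝ (S k l) y := by
      obtain ⟨c₁, c₂, e, h1, h2⟩ := hdiff y hy
      rw [e]
      exact (h1.smul (hσ y (hball y hy).2)).add (h2.smul (hτ y (hball y hy).2))
    refine (convex_ball x ε).is_const_of_fderivWithin_eq_zero
      (fun y hy => (hdiffS y hy).differentiableWithinAt) (fun y hy => ?_) hy
      (Metric.mem_ball_self hε)
    rw [fderivWithin_of_isOpen Metric.isOpen_ball hy]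
    ext X
    have hmem : fderiv ℝ (S k l) y X ∈ Submodule.span ℝ {σ y, τ y} := by
      obtain ⟨c₁, c₂, e, h1, h2⟩ := hdiff y hy
      have hyU := (hball y hy).2
      have := ((h1.hasFDerivAt.smul (hσ y hyU).hasFDerivAt).add
        (h2.hasFDerivAt.smul (hτ y hyU).hasFDerivAt)).fderiv
      rw [e]
      erw [this]
      simp only [add_apply, smul_apply,
        ContinuousLinearMap.smulRight_apply]
      exact add_mem (add_mem (Submodule.smul_mem _ _ (hσ' y hyU X))
        (Submodule.smul_mem _ _ (Submodule.subset_span (by simp))))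
        (add_mem (Submodule.smul_mem _ _ (hτ' y hyU X))
        (Submodule.smul_mem _ _ (Submodule.subset_span (by simp))))
    have hconst (C : E →L[ℝ] ℝ) (c : ℝ) (hc : ∀ y ∈ Metric.ball x ε, C (S k l y) = c) :
        C (fderiv ℝ (S k l) y X) = 0 := by
      have h1 := (C.hasFDerivAt.comp y (hdiffS y hy).hasFDerivAt).fderiv
      have h2 : C ∘ S k l =ᶠ[nhds y] fun _ => c :=
        Filter.eventually_of_mem (Metric.isOpen_ball.mem_nhds hy) hc
      rw [h2.fderiv_eq, fderiv_fun_const] at h1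
      exact (DFunLike.congr_fun h1 X).symm
    have h1 := hconst A k fun y hy => by
      have := (hball y hy).1
      simp only [S, map_add, map_smul, smul_eq_mul]
      field_simp
      simp only [D]; ring
    have h2 := hconst B l fun y hy => by
      have := (hball y hy).1
      simp only [S, map_add, map_smul, smul_eq_mul]
      field_simp
      simp only [D]; ring
    obtain ⟨m, n, hmn⟩ := Submodule.mem_span_pair.1 hmem
    rw [← hmn, map_add, map_smul, map_smul, smul_eq_mul, smul_eq_mul] at h1 h2
    have hDy := (hball y hy).1
    have hm : m = 0 := by
      apply (mul_eq_zero.1 (_ : m * D y = 0)).resolve_right hDy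
      simp only [D]
      linear_combination B (τ y) * h1 - A (τ y) * h2
    have hn : n = 0 := by
      apply (mul_eq_zero.1 (_ : n * D y = 0)).resolve_right hDy
      simp only [D]
      linear_combination A (σ y) * h2 - B (σ y) * h1
    rw [← hmn, hm, hn]
    simp
  have hSmem (k l y) : S k l y ∈ Submodule.span ℝ {σ y, τ y} :=
    Submodule.mem_span_pair.2 ⟨_, _, rfl⟩
  have hσS (y) (hy : y ∈ Metric.ball x ε) : S (A (σ y)) (B (σ y)) y = σ y := by
    have hDy := (hball y hy).1
    have e1 : (A (σ y) * B (τ y) - B (σ y) * A (τ y)) / D y = 1 := by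
      rw [div_eq_one_iff_eq hDy]; simp only [D]; ring
    have e2 : B (σ y) * A (σ y) - A (σ y) * B (σ y) = 0 := by ring
    simp only [S, e1, e2]
    simp
  have hτS (y) (hy : y ∈ Metric.ball x ε) : S (A (τ y)) (B (τ y)) y = τ y := by
    have hDy := (hball y hy).1
    have e1 : (B (τ y) * A (σ y) - A (τ y) * B (σ y)) / D y = 1 := by
      rw [div_eq_one_iff_eq hDy]; simp only [D]; ring
    have e2 : A (τ y) * B (τ y) - B (τ y) * A (τ y) = 0 := by ring
    simp only [S, e1, e2]
    simp
  filter_upwards [Metric.ball_mem_nhds x hε] with y hy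
  apply le_antisymm <;> rw [Submodule.span_le] <;> rintro _ (rfl | rfl) <;> rw [SetLike.mem_coe]
  · rw [← hσS y hy, hS _ _ hy]
    exact hSmem _ _ _
  · rw [← hτS y hy, hS _ _ hy]
    exact hSmem _ _ _
  · rw [← hσS x (Metric.mem_ball_self hε), ← hS _ _ hy]
    exact hSmem _ _ _
  · rw [← hτS x (Metric.mem_ball_self hε), ← hS _ _ hy]
    exact hSmem _ _ _


/-! ### Differentiation of sections, and Legendre maps. -/

/-- The metric as a continuous bilinear map. -/
noncomputable def lieFormL : R42 →L[ℝ] R42 →L[ℝ] ℝ :=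
  LinearMap.toContinuousBilinearMap lieForm

theorem hasFDerivAt_lieForm {V : Type*} [NormedAddCommGroup V] [NormedSpace ℝ V] {s t : V → R42}
    {x : V} (hs : DifferentiableAt ℝ s x) (ht : DifferentiableAt ℝ t x) :
    ∃ L : V →L[ℝ] ℝ, HasFDerivAt (fun y => lieForm (s y) (t y)) L x ∧
      ∀ X, L X = lieForm (s x) (fderiv ℝ t x X) + lieForm (fderiv ℝ s x X) (t x) :=
  ⟨_, lieFormL.hasFDerivAt_of_bilinear hs.hasFDerivAt ht.hasFDerivAt, fun _ => rfl⟩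

theorem orthogonalTo_iff {M : Type*} {a p : R42} (hp : lieForm p p = -1) (ha : lieForm a a ≠ 0)
    {f g : M → Submodule ℝ R42} {q r : M → R42} (h : ∀ x, IsDualFrame a p (f x) (q x) (r x)) :
    OrthogonalTo p g (circleCongruence p f (invertMap a f)) ↔
      ∀ x, g x ≤ f x ⊔ Submodule.span ℝ {a, p} := by
  refine forall_congr' fun x => ⟨fun H s hs => ?_, fun H s hs _ => ?_⟩
  · by_cases hs0 : s = 0
    · rw [hs0]; exact zero_mem _
    · exact ((h x).circleOrthogonal_iff hp ha).1 (H s hs hs0)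
  · exact ((h x).circleOrthogonal_iff hp ha).2 (H hs)

variable {M : Type*} [TopologicalSpace M] [ChartedSpace (EuclideanSpace ℝ (Fin 2)) M]

theorem sectionDeriv_eq {s : M → R42} {x : M}
    (hs : MDifferentiableAt (𝓡 2) 𝓘(ℝ, R42) s x) (v : TangentSpace (𝓡 2) x) :
    sectionDeriv s x v = fderiv ℝ (s ∘ (extChartAt (𝓡 2) x).symm) (extChartAt (𝓡 2) x x) v := by
  rw [sectionDeriv, hs.mfderiv, writtenInExtChartAt, extChartAt_model_space_eq_id,
    ModelWithCorners.Boundaryless.range_eq_univ, fderivWithin_univ]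
  rfl

theorem differentiableAt_comp_extChartAt_symm {s : M → R42} {x : M}
    (hs : MDifferentiableAt (𝓡 2) 𝓘(ℝ, R42) s x) :
    DifferentiableAt ℝ (s ∘ (extChartAt (𝓡 2) x).symm) (extChartAt (𝓡 2) x x) := by
  have h := hs.2
  unfold DifferentiableWithinAtProp at h
  rw [ModelWithCorners.Boundaryless.range_eq_univ, Set.inter_univ, Set.preimage_univ,
    Set.preimage_univ, differentiableWithinAt_univ] at h
  exact h

theorem lieForm_sectionDeriv_add {s t : M → R42} {x : M}
    (hs : MDifferentiableAt (𝓡 2) 𝓘(ℝ, R42) s x) (ht : MDifferentiableAt (𝓡 2) 𝓘(ℝ, R42) t x)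
    {c : ℝ} (hc : ∀ᶠ y in nhds x, lieForm (s y) (t y) = c) (v : TangentSpace (𝓡 2) x) :
    lieForm (s x) (sectionDeriv t x v) + lieForm (sectionDeriv s x v) (t x) = 0 := by
  obtain ⟨L, hL, hL'⟩ := hasFDerivAt_lieForm (differentiableAt_comp_extChartAt_symm hs)
    (differentiableAt_comp_extChartAt_symm ht)
  have h := hL' v
  simp only [Function.comp_apply, extChartAt_to_inv] at h
  rw [sectionDeriv_eq hs, sectionDeriv_eq ht, ← h]
  have hc' : (fun y => lieForm ((s ∘ (extChartAt (𝓡 2) x).symm) y)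
      ((t ∘ (extChartAt (𝓡 2) x).symm) y)) =ᶠ[nhds (extChartAt (𝓡 2) x x)] fun _ => c := by
    have hcont := continuousAt_extChartAt_symm (I := 𝓡 2) x
    rw [ContinuousAt, extChartAt_to_inv] at hcont
    exact hcont.eventually hc
  rw [(hL.congr_of_eventuallyEq hc'.symm).unique (hasFDerivAt_const c _)]
  rfl

theorem IsSection.mdifferentiableAt {f : M → Submodule ℝ R42} {U : Set M} {s : M → R42}
    (h : IsSection f U s) (hU : IsOpen U) {x : M} (hx : x ∈ U) :
    MDifferentiableAt (𝓡 2) 𝓘(ℝ, R42) s x :=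
  (h.1.contMDiffAt (hU.mem_nhds hx)).mdifferentiableAt (by simp)

/-- The Legendre condition needs to be checked on a local frame only. -/
theorem isLegendreMap_of_frame {g : M → Submodule ℝ R42} (hg : ∀ x, IsContactElement (g x))
    (hfr : ∀ x, ∃ U : Set M, IsOpen U ∧ x ∈ U ∧ ∃ s t : M → R42, IsSection g U s ∧
      IsSection g U t ∧ (∀ y ∈ U, g y = Submodule.span ℝ {s y, t y}) ∧
      ∀ v, lieForm (sectionDeriv s x v) (t x) = 0) : IsLegendreMap g := by
  refine ⟨hg, fun x => ?_, fun V hV s' t' hs' ht' x hx v => ?_⟩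
  · obtain ⟨U, hU, hx, s, t, hs, ht, hst, -⟩ := hfr x
    exact ⟨U, hU, hx, s, t, hs, ht, hst⟩
  obtain ⟨U, hU, hxU, s, t, hs, ht, hst, hd⟩ := hfr x
  -- Differentiating `⟨u, w⟩ = 0` moves the derivative from `t'` to the frame. Then `s' x` and `t'
  -- x` need to be expanded only at the point, so the coefficient functions are never
  -- differentiated.
  have hnull {W W' : Set M} (hW : IsOpen W) (hW' : IsOpen W') (hxW : x ∈ W) (hxW' : x ∈ W')
      {u w : M → R42} (hu : IsSection g W u) (hw : IsSection g W' w) :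
      lieForm (u x) (sectionDeriv w x v) + lieForm (sectionDeriv u x v) (w x) = 0 :=
    lieForm_sectionDeriv_add (hu.mdifferentiableAt hW hxW) (hw.mdifferentiableAt hW' hxW')
      (Filter.eventually_of_mem (Filter.inter_mem (hW.mem_nhds hxW) (hW'.mem_nhds hxW'))
        fun y hy => (hg y).2 _ (hu.2 y hy.1) _ (hw.2 y hy.2)) v
  have hss := hnull hU hU hxU hxU hs hs
  have htt := hnull hU hU hxU hxU ht ht
  have hst' := hnull hU hU hxU hxU hs ht
  have hst'' := hd v
  have h1 := hnull hU hV hxU hx hs ht'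
  have h2 := hnull hU hV hxU hx ht ht'
  have h3 := hs'.2 x hx
  have h4 := ht'.2 x hx
  rw [hst x hxU, Submodule.mem_span_pair] at h3 h4
  obtain ⟨α, β, h3⟩ := h3
  obtain ⟨γ, δ, h4⟩ := h4
  rw [← h4] at h1 h2
  rw [← h3]
  have e1 := lieForm_comm (sectionDeriv s x v) (s x)
  have e2 := lieForm_comm (sectionDeriv t x v) (t x)
  have e3 := lieForm_comm (sectionDeriv t x v) (s x)
  have e4 : lieForm (s x) (sectionDeriv s x v) = 0 := by linarith
  have e5 : lieForm (t x) (sectionDeriv t x v) = 0 := by linarith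
  have e6 : lieForm (s x) (sectionDeriv t x v) = 0 := by linarith
  simp only [map_add, map_smul, smul_eq_mul, e1, e2, e3, e4, e5, e6, hst''] at h1 h2
  simp only [map_add, map_smul, smul_eq_mul, LinearMap.add_apply, LinearMap.smul_apply]
  have h1' : lieForm (s x) (sectionDeriv t' x v) = 0 := by linarith
  have h2' : lieForm (t x) (sectionDeriv t' x v) = 0 := by linarith
  rw [h1', h2']
  ring

theorem contMDiffOn_comp_linear {E : Type*} [NormedAddCommGroup E] [NormedSpace ℝ E]
    {U : Set M} {s : M → R42}
    (hs : ContMDiffOn (𝓡 2) 𝓘(ℝ, R42) ∞ s U) (L : R42 →ₗ[ℝ] E) :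
    ContMDiffOn (𝓡 2) 𝓘(ℝ, E) ∞ (fun y => L (s y)) U :=
  (LinearMap.toContinuousLinearMap L).contMDiff.comp_contMDiffOn hs

theorem contMDiffOn_lieForm_right {U : Set M} {s : M → R42}
    (hs : ContMDiffOn (𝓡 2) 𝓘(ℝ, R42) ∞ s U) (c : R42) :
    ContMDiffOn (𝓡 2) 𝓘(ℝ, ℝ) ∞ (fun y => lieForm (s y) c) U :=
  contMDiffOn_comp_linear hs (lieForm.flip c)

theorem sectionDeriv_comp_linear {s : M → R42} {x : M}
    (hs : MDifferentiableAt (𝓡 2) 𝓘(ℝ, R42) s x) (L : R42 →ₗ[ℝ] R42)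
    (v : TangentSpace (𝓡 2) x) :
    sectionDeriv (fun y => L (s y)) x v = L (sectionDeriv s x v) := by
  have hL : MDifferentiableAt 𝓘(ℝ, R42) 𝓘(ℝ, R42) (LinearMap.toContinuousLinearMap L) (s x) :=
    (LinearMap.toContinuousLinearMap L).differentiableAt.mdifferentiableAt
  have := mfderiv_comp_apply x hL hs v
  rw [mfderiv_eq_fderiv, ContinuousLinearMap.fderiv] at this
  exact this

/-- A Lie inversion is a fixed linear isometry: it commutes with differentiation and preserves the
contact condition. -/
theorem IsLegendreMap.invertMap {b : R42} (hb : lieForm b b ≠ 0) {f : M → Submodule ℝ R42}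
    (hf : IsLegendreMap f) : IsLegendreMap (invertMap b f) := by
  apply isLegendreMap_of_frame fun x => (hf.1 x).invert hb
  intro x
  obtain ⟨U, hU, hx, s, t, hs, ht, hst⟩ := hf.2.1 x
  refine ⟨U, hU, hx, fun y => lieInversion b (s y), fun y => lieInversion b (t y),
    ⟨contMDiffOn_comp_linear hs.1 _, fun y hy => ⟨_, hs.2 y hy, rfl⟩⟩,
    ⟨contMDiffOn_comp_linear ht.1 _, fun y hy => ⟨_, ht.2 y hy, rfl⟩⟩, fun y hy => ?_,
    fun v => ?_⟩
  · rw [invert, hst y hy, Submodule.map_span, Set.image_pair]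
  · rw [sectionDeriv_comp_linear (hs.mdifferentiableAt hU hx), lieForm_lieInversion hb,
      lieForm_comm]
    exact hf.2.2 U hU t s ht hs x hx v

/-- A smooth dual frame of `f`. -/
theorem exists_smooth_isDualFrame {a p : R42} (hp : lieForm p p = -1) (ha : lieForm a a ≠ 0)
    {f : M → Submodule ℝ R42} (hf : IsLegendreMap f)
    (hpt : ∀ x, pointSphere p (f x) ≠ pointSphere p (invert a (f x))) :
    ∃ q r : M → R42, (∀ x, IsDualFrame a p (f x) (q x) (r x)) ∧
      ContMDiff (𝓡 2) 𝓘(ℝ, R42) ∞ q ∧ ContMDiff (𝓡 2) 𝓘(ℝ, R42) ∞ r := by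
  choose q r h using fun x => exists_isDualFrame hp ha (hf.1 x) (hpt x)
  refine ⟨q, r, h, ?_⟩
  have key (x : M) : ContMDiffAt (𝓡 2) 𝓘(ℝ, R42) ∞ q x ∧ ContMDiffAt (𝓡 2) 𝓘(ℝ, R42) ∞ r x := by
    obtain ⟨U, hU, hx, s, t, hs, ht, hst⟩ := hf.2.1 x
    have hsa := contMDiffOn_lieForm_right hs.1 a
    have hsp := contMDiffOn_lieForm_right hs.1 p
    have hta := contMDiffOn_lieForm_right ht.1 a
    have htp := contMDiffOn_lieForm_right ht.1 p
    -- The determinant of the products of `s`, `t` with `a`, `p`. It is nonzero because a dual frame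
    -- exists, and Cramer's rule then gives `q` and `r` smoothly in terms of `s`, `t`.
    let D : M → ℝ := fun y => lieForm (s y) a * lieForm (t y) p - lieForm (s y) p * lieForm (t y) a
    have hD : ContMDiffOn (𝓡 2) 𝓘(ℝ, ℝ) ∞ D U := (hsa.mul htp).sub (hsp.mul hta)
    have hD0 (y) (hy : y ∈ U) : D y ≠ 0 := by
      have hq := (h y).left_mem
      have hr := (h y).right_mem
      rw [hst y hy, Submodule.mem_span_pair] at hq hr
      obtain ⟨α, β, hq⟩ := hq
      obtain ⟨γ, δ, hr⟩ := hr
      have e1 := (h y).qa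
      have e2 := (h y).qp
      have e3 := (h y).ra
      have e4 := (h y).rp
      rw [← hq] at e1 e2
      rw [← hr] at e3 e4
      simp only [map_add, map_smul, LinearMap.add_apply, LinearMap.smul_apply, smul_eq_mul]
        at e1 e2 e3 e4
      intro h0
      have : (α * δ - β * γ) * D y = 1 := by
        simp only [D]
        linear_combination (α * lieForm (s y) a + β * lieForm (t y) a) * e4 + e1 -
          (γ * lieForm (s y) a + δ * lieForm (t y) a) * e2
      rw [h0, mul_zero] at this
      exact zero_ne_one this
    have hq (y) (hy : y ∈ U) :
        q y = (lieForm (t y) p * (D y)⁻¹) • s y + (-lieForm (s y) p * (D y)⁻¹) • t y := by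
      have h1 := (h y).eq_combination (hs.2 y hy)
      have h2 := (h y).eq_combination (ht.2 y hy)
      have hDy := hD0 y hy
      have e : lieForm (t y) p • s y - lieForm (s y) p • t y = D y • q y := by
        conv_lhs => rw [h1, h2]
        simp only [D]
        simp only [map_add, map_smul, LinearMap.add_apply, LinearMap.smul_apply, smul_eq_mul,
          (h y).qp, (h y).rp]
        module
      rw [← inv_smul_smul₀ hDy (q y), ← e]
      module
    have hr (y) (hy : y ∈ U) :
        r y = (-lieForm (t y) a * (D y)⁻¹) • s y + (lieForm (s y) a * (D y)⁻¹) • t y := by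
      have h1 := (h y).eq_combination (hs.2 y hy)
      have h2 := (h y).eq_combination (ht.2 y hy)
      have hDy := hD0 y hy
      have e : lieForm (s y) a • t y - lieForm (t y) a • s y = D y • r y := by
        conv_lhs => rw [h1, h2]
        simp only [D]
        simp only [map_add, map_smul, LinearMap.add_apply, LinearMap.smul_apply, smul_eq_mul,
          (h y).qa, (h y).ra]
        module
      rw [← inv_smul_smul₀ hDy (r y), ← e]
      module
    have hDi := hD.inv₀ hD0
    exact ⟨((((htp.mul hDi).smul hs.1).add ((hsp.neg.mul hDi).smul ht.1)).congr hq).contMDiffAt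
        (hU.mem_nhds hx),
      ((((hta.neg.mul hDi).smul hs.1).add ((hsa.mul hDi).smul ht.1)).congr hr).contMDiffAt
        (hU.mem_nhds hx)⟩
  exact ⟨fun x => (key x).1, fun x => (key x).2⟩

/-- The derivatives of a dual frame of a Legendre map are orthogonal to the frame, `a`, and `p`. -/
theorem IsLegendreMap.frame_deriv {a p : R42} {f : M → Submodule ℝ R42} (hf : IsLegendreMap f)
    {q r : M → R42} (h : ∀ x, IsDualFrame a p (f x) (q x) (r x))
    (hq : ContMDiff (𝓡 2) 𝓘(ℝ, R42) ∞ q) (hr : ContMDiff (𝓡 2) 𝓘(ℝ, R42) ∞ r) {s : M → R42}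
    (hs : s = q ∨ s = r) (x : M) (v : TangentSpace (𝓡 2) x) {u : R42}
    (hu : u ∈ f x ⊔ Submodule.span ℝ {a, p}) : lieForm u (sectionDeriv s x v) = 0 := by
  have hqs : IsSection f Set.univ q := ⟨hq.contMDiffOn, fun x _ => (h x).left_mem⟩
  have hrs : IsSection f Set.univ r := ⟨hr.contMDiffOn, fun x _ => (h x).right_mem⟩
  have hss : IsSection f Set.univ s := by rcases hs with rfl | rfl <;> assumption
  have hL := hf.2.2 Set.univ isOpen_univ
  -- The products with `a` and `p` are constant by duality; those with `q` and `r` are handled by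
  -- the contact condition.
  have hc (b : R42) (c : ℝ) (hb : ∀ y, lieForm (s y) b = c) :
      lieForm (sectionDeriv s x v) b = 0 := by
    have h1 := lieForm_sectionDeriv_add (hss.mdifferentiableAt isOpen_univ (Set.mem_univ x))
      (mdifferentiableAt_const (c := b)) (Filter.Eventually.of_forall hb) v
    have h2 : sectionDeriv (fun _ : M => b) x v = 0 := by
      rw [sectionDeriv, mfderiv_const]; rfl
    rwa [h2, map_zero, zero_add] at h1
  apply (h x).lieForm_eq_zero_of_mem hu
  · rw [lieForm_comm]
    exact hL q s hqs hss x (Set.mem_univ x) v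
  · rw [lieForm_comm]
    exact hL r s hrs hss x (Set.mem_univ x) v
  · rcases hs with rfl | rfl
    · exact hc a 1 fun y => (h y).qa
    · exact hc a 0 fun y => (h y).ra
  · rcases hs with rfl | rfl
    · exact hc p 0 fun y => (h y).qp
    · exact hc p 1 fun y => (h y).rp

/-- With `b = k a + l p`, the frame `l q - k r`, `b` has a constant second member, so the contact
condition is the derivative of `⟨l q - k r, b⟩ = 0`. -/
theorem IsLegendreMap.umbilicMap {a p : R42} {f : M → Submodule ℝ R42}
    {q r : M → R42} (h : ∀ x, IsDualFrame a p (f x) (q x) (r x))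
    (hq : ContMDiff (𝓡 2) 𝓘(ℝ, R42) ∞ q) (hr : ContMDiff (𝓡 2) 𝓘(ℝ, R42) ∞ r) {b : R42}
    (hb : b ∈ nullSpan a p) : IsLegendreMap (umbilicMap b f) := by
  obtain ⟨hb, hbs⟩ := hb
  obtain ⟨k, l, rfl⟩ := Submodule.mem_span_pair.1 hb
  have hkl : k ≠ 0 ∨ l ≠ 0 := by
    by_contra! h0
    exact hbs.1 (by simp [h0.1, h0.2])
  have hsp (x : M) : LieSphere.umbilicMap (k • a + l • p) f x =
      Submodule.span ℝ {l • q x - k • r x, k • a + l • p} := (h x).umbilicElement_eq hkl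
  apply isLegendreMap_of_frame fun x => (h x).isContactElement_umbilicElement hbs
  intro x
  have h1 : IsSection (LieSphere.umbilicMap (k • a + l • p) f) Set.univ
      (fun y => l • q y - k • r y) := by
    refine ⟨?_, fun y _ => hsp y ▸ Submodule.subset_span (by simp)⟩
    have hsmul (c : ℝ) {u : M → R42} (hu : ContMDiff (𝓡 2) 𝓘(ℝ, R42) ∞ u) :
        ContMDiff (𝓡 2) 𝓘(ℝ, R42) ∞ fun y => c • u y :=
      (contMDiff_const (I' := 𝓘(ℝ, ℝ)) (c := c)).smul hu
    exact ((hsmul l hq).sub (hsmul k hr)).contMDiffOn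
  have h2 : IsSection (LieSphere.umbilicMap (k • a + l • p) f) Set.univ
      (fun _ => k • a + l • p) :=
    ⟨contMDiffOn_const, fun y _ => hsp y ▸ Submodule.subset_span (by simp)⟩
  refine ⟨Set.univ, isOpen_univ, Set.mem_univ x, _, _, h1, h2, fun y _ => hsp y, fun v => ?_⟩
  have h3 := lieForm_sectionDeriv_add (h1.mdifferentiableAt isOpen_univ (Set.mem_univ x))
    (h2.mdifferentiableAt isOpen_univ (Set.mem_univ x))
    (Filter.Eventually.of_forall fun y => (h y).perp_combination k l) v
  have h4 : sectionDeriv (fun _ : M => k • a + l • p) x v = 0 := by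
    rw [sectionDeriv, mfderiv_const]; rfl
  rwa [h4, map_zero, zero_add] at h3

/-! ### Rigidity of Legendre maps in the four-space bundle. -/

/-- The products of a Legendre map in `f ⊔ span(a, p)` with a dual frame are locally constant. -/
theorem IsLegendreMap.isLocallyConstant [IsManifold (𝓡 2) ∞ M] {a p : R42} (hp : lieForm p p = -1)
    {f g : M → Submodule ℝ R42} (hf : IsLegendreMap f) (hg : IsLegendreMap g)
    {q r : M → R42} (h : ∀ x, IsDualFrame a p (f x) (q x) (r x))
    (hq : ContMDiff (𝓡 2) 𝓘(ℝ, R42) ∞ q) (hr : ContMDiff (𝓡 2) 𝓘(ℝ, R42) ∞ r)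
    (hgf : ∀ x, g x ≤ f x ⊔ Submodule.span ℝ {a, p}) :
    IsLocallyConstant fun x => (g x).map (pairing a p (q x) (r x)) := by
  rw [IsLocallyConstant.iff_eventually_eq]
  intro x
  obtain ⟨U, hU, hx, s, t, hs, ht, hst⟩ := hg.2.1 x
  let e := chartAt (EuclideanSpace ℝ (Fin 2)) x
  have hV : IsOpen (e.target ∩ e.symm ⁻¹' U) := e.isOpen_inter_preimage_symm hU
  have hxe : e.symm (e x) = x := e.left_inv (mem_chart_source _ x)
  have hxV : e x ∈ e.target ∩ e.symm ⁻¹' U :=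
    ⟨mem_chart_target _ x, by rw [Set.mem_preimage, hxe]; exact hx⟩
  have hone : (1 : WithTop ℕ∞) ≤ ∞ := by exact_mod_cast le_top
  have : IsManifold (𝓡 2) 1 M := IsManifold.of_le hone
  have hpull {u : M → R42} {z} (hz : z ∈ e.target)
      (hu : MDifferentiableAt (𝓡 2) 𝓘(ℝ, R42) u (e.symm z)) :
      DifferentiableAt ℝ (u ∘ e.symm) z ∧ ∀ X, fderiv ℝ (u ∘ e.symm) z X =
        sectionDeriv u (e.symm z) (mfderiv (𝓡 2) (𝓡 2) e.symm z X) := by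
    have he : MDifferentiableAt (𝓡 2) (𝓡 2) e.symm z :=
      mdifferentiableAt_atlas_symm (chart_mem_atlas _ x) hz
    refine ⟨(hu.comp z he).differentiableAt, fun X => ?_⟩
    have h1 := mfderiv_comp_apply z hu he X
    rw [mfderiv_eq_fderiv] at h1
    exact h1
  have hqz (z) : MDifferentiableAt (𝓡 2) 𝓘(ℝ, R42) q z := (hq z).mdifferentiableAt (by simp)
  have hrz (z) : MDifferentiableAt (𝓡 2) 𝓘(ℝ, R42) r z := (hr z).mdifferentiableAt (by simp)
  let P : (M → R42) → EuclideanSpace ℝ (Fin 2) → (Fin 4 → ℝ) := fun u z =>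
    pairing a p (q (e.symm z)) (r (e.symm z)) (u (e.symm z))
  have hP {u : M → R42} (hu : IsSection g U u) {z} (hz : z ∈ e.target ∩ e.symm ⁻¹' U) :
      DifferentiableAt ℝ (P u) z ∧ ∀ X, fderiv ℝ (P u) z X ∈
        (g (e.symm z)).map (pairing a p (q (e.symm z)) (r (e.symm z))) := by
    obtain ⟨du, du'⟩ := hpull hz.1 (hu.mdifferentiableAt hU hz.2)
    obtain ⟨dq, dq'⟩ := hpull hz.1 (hqz _)
    obtain ⟨dr, dr'⟩ := hpull hz.1 (hrz _)
    have huW := hgf _ (hu.2 _ hz.2)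
    obtain ⟨L₁, h₁, h₁'⟩ := hasFDerivAt_lieForm du dq
    obtain ⟨L₂, h₂, h₂'⟩ := hasFDerivAt_lieForm du dr
    obtain ⟨L₃, h₃, h₃'⟩ := hasFDerivAt_lieForm du (differentiableAt_const a)
    obtain ⟨L₄, h₄, h₄'⟩ := hasFDerivAt_lieForm du (differentiableAt_const p)
    have hPd : HasFDerivAt (P u) (ContinuousLinearMap.pi ![L₁, L₂, L₃, L₄]) z := by
      rw [hasFDerivAt_pi]
      intro i
      have hPu : P u = fun z => ![lieForm (u (e.symm z)) (q (e.symm z)),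
          lieForm (u (e.symm z)) (r (e.symm z)), lieForm (u (e.symm z)) a,
          lieForm (u (e.symm z)) p] := funext fun z => pairing_apply _ _ _ _ _
      change HasFDerivAt (fun z => P u z i) _ z
      rw [hPu]
      fin_cases i
      · exact h₁
      · exact h₂
      · exact h₃
      · exact h₄
    refine ⟨hPd.differentiableAt, fun X => ?_⟩
    -- The terms `⟨u, dq⟩` and `⟨u, dr⟩` vanish because the frame is parallel, so differentiating
    -- the coordinates of `u` amounts to pairing `du` with the frame.
    have : fderiv ℝ (P u) z X = pairing a p (q (e.symm z)) (r (e.symm z))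
        (sectionDeriv u (e.symm z) (mfderiv (𝓡 2) (𝓡 2) e.symm z X)) := by
      rw [hPd.fderiv, pairing_apply, ← du']
      ext i
      fin_cases i
      · refine (h₁' X).trans ?_
        rw [dq', Function.comp_apply, hf.frame_deriv h hq hr (Or.inl rfl) _ _ huW, zero_add]
        rfl
      · refine (h₂' X).trans ?_
        rw [dr', Function.comp_apply, hf.frame_deriv h hq hr (Or.inr rfl) _ _ huW, zero_add]
        rfl
      · refine (h₃' X).trans ?_
        simp
      · refine (h₄' X).trans ?_
        simp
    rw [this]
    -- By the Legendre condition on `g`, `du` is orthogonal to `g`.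
    apply (h _).pairing_mem hp (hg.1 _) (hgf _)
    intro w hw
    rw [hst _ hz.2, Submodule.mem_span_pair] at hw
    obtain ⟨α, β, rfl⟩ := hw
    rw [map_add, map_smul, map_smul, LinearMap.add_apply, LinearMap.smul_apply,
      LinearMap.smul_apply, hg.2.2 U hU s u hs hu _ hz.2, hg.2.2 U hU t u ht hu _ hz.2]
    simp
  have hmap {y} (hy : y ∈ U) : (g y).map (pairing a p (q y) (r y)) = Submodule.span ℝ
      {pairing a p (q y) (r y) (s y), pairing a p (q y) (r y) (t y)} := by
    rw [hst y hy, Submodule.map_span, Set.image_pair]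
  have hmain := eventually_span_eq hV hxV (fun z hz => (hP hs hz).1) (fun z hz => (hP ht hz).1) ?_
    (fun z hz X => hmap hz.2 ▸ (hP hs hz).2 X) (fun z hz X => hmap hz.2 ▸ (hP ht hz).2 X)
  · have hcont : ContinuousAt e x := e.continuousAt (mem_chart_source _ x)
    filter_upwards [hcont.eventually hmain, hU.mem_nhds hx,
      e.open_source.mem_nhds (mem_chart_source _ x)] with y hy hyU hye
    rw [hmap hyU, hmap hx]
    simpa only [P, hxe, e.left_inv hye] using hy
  · rw [LinearIndependent.pair_iff]
    simp only [P, hxe]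
    intro α β h0
    rw [← map_smul, ← map_smul, ← map_add] at h0
    obtain ⟨h1, h2, h3, h4⟩ := pairing_eq_zero.1 h0
    have h5 := (h x).eq_zero_of_mem hp (hgf x (add_mem (Submodule.smul_mem _ α (hs.2 x hx))
      (Submodule.smul_mem _ β (ht.2 x hx)))) h1 h2 h3 h4
    have hfin : Module.finrank ℝ (Submodule.span ℝ (Set.range ![s x, t x])) = 2 := by
      rw [Matrix.range_cons_cons_empty, ← hst x hx]
      exact (hg.1 x).1
    have hli : LinearIndependent ℝ ![s x, t x] :=
      linearIndependent_iff_card_eq_finrank_span.2 (by rw [Fintype.card_fin]; exact hfin.symm)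
    exact LinearIndependent.pair_iff.1 hli α β h5

/-- Legendre maps in `f ⊔ span(a, p)` that agree at a point coincide. -/
theorem IsLegendreMap.eq_of_eq_at [IsManifold (𝓡 2) ∞ M] [PreconnectedSpace M] {a p : R42}
    (hp : lieForm p p = -1) {f g g' : M → Submodule ℝ R42} (hf : IsLegendreMap f)
    (hg : IsLegendreMap g) (hg' : IsLegendreMap g')
    {q r : M → R42} (h : ∀ x, IsDualFrame a p (f x) (q x) (r x))
    (hq : ContMDiff (𝓡 2) 𝓘(ℝ, R42) ∞ q) (hr : ContMDiff (𝓡 2) 𝓘(ℝ, R42) ∞ r)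
    (hgf : ∀ x, g x ≤ f x ⊔ Submodule.span ℝ {a, p})
    (hgf' : ∀ x, g' x ≤ f x ⊔ Submodule.span ℝ {a, p}) {x₀ : M} (h0 : g x₀ = g' x₀) : g = g' := by
  ext1 x
  apply (h x).eq_of_map_pairing_eq hp (hgf x) (hgf' x)
  rw [(hf.isLocallyConstant hp hg h hq hr hgf).apply_eq_of_preconnectedSpace x x₀,
    (hf.isLocallyConstant hp hg' h hq hr hgf').apply_eq_of_preconnectedSpace x x₀, h0]

end LieSphere

/-! ### The main theorem. -/

theorem mainTheorem5 {M : Type*} [TopologicalSpace M]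
    [ChartedSpace (EuclideanSpace ℝ (Fin 2)) M] [IsManifold (𝓡 2) ∞ M]
    (p : LieSphere.R42) (hp : LieSphere.lieForm p p = -1)
    (a : LieSphere.R42) (ha : LieSphere.lieForm a a ≠ 0)
    (f : M → Submodule ℝ LieSphere.R42)
    (hf : LieSphere.IsRibaucourPair f (LieSphere.invertMap a f))
    (hpt : ∀ x, LieSphere.pointSphere p (f x) ≠
      LieSphere.pointSphere p (LieSphere.invert a (f x))) :
    (∀ x, LieSphere.IsCircle p
      (LieSphere.circleCongruence p f (LieSphere.invertMap a f) x)) ∧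
    (∀ b ∈ LieSphere.nonnullSpan a p,
      LieSphere.IsLegendreMap (LieSphere.invertMap b f) ∧
      LieSphere.OrthogonalTo p (LieSphere.invertMap b f)
        (LieSphere.circleCongruence p f (LieSphere.invertMap a f))) ∧
    (∀ b ∈ LieSphere.nonnullSpan a p, ∀ b' ∈ LieSphere.nonnullSpan a p, ∀ x,
      LieSphere.invert b (f x) = LieSphere.invert b' (f x) →
      Submodule.span ℝ {b} = Submodule.span ℝ {b'}) ∧
    (∀ b ∈ LieSphere.nullSpan a p,
      LieSphere.IsLegendreMap (LieSphere.umbilicMap b f) ∧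
      LieSphere.OrthogonalTo p (LieSphere.umbilicMap b f)
        (LieSphere.circleCongruence p f (LieSphere.invertMap a f))) ∧
    (ConnectedSpace M → ∀ g : M → Submodule ℝ LieSphere.R42,
      (LieSphere.IsLegendreMap g ∧
        LieSphere.OrthogonalTo p g
          (LieSphere.circleCongruence p f (LieSphere.invertMap a f))) ↔
        ∃ h : M → Submodule ℝ LieSphere.R42,
          ((∃ b ∈ LieSphere.nonnullSpan a p, h = LieSphere.invertMap b f) ∨
            (∃ b ∈ LieSphere.nullSpan a p, h = LieSphere.umbilicMap b f)) ∧
          (g = h ∨ g = LieSphere.invertMap p h)) := by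
  have hp0 : LieSphere.lieForm p p ≠ 0 := by rw [hp]; norm_num
  have hpmem : p ∈ Submodule.span ℝ {a, p} := Submodule.mem_span_pair.2 ⟨0, 1, by simp⟩
  have hL := hf.1
  obtain ⟨q, r, h, hq, hr⟩ := LieSphere.exists_smooth_isDualFrame hp ha hL hpt
  have horth {g : M → Submodule ℝ LieSphere.R42} :=
    LieSphere.orthogonalTo_iff (g := g) hp ha h
  have hinv {b} (hb : b ∈ LieSphere.nonnullSpan a p) (x : M) :
      LieSphere.invert b (f x) ≤ f x ⊔ Submodule.span ℝ {a, p} :=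
    LieSphere.invert_le hb.1 le_sup_left
  have humb {b} (hb : b ∈ LieSphere.nullSpan a p) (x : M) :
      LieSphere.umbilicElement b (f x) ≤ f x ⊔ Submodule.span ℝ {a, p} :=
    LieSphere.umbilicElement_le hb.1
  refine ⟨fun x => (h x).isCircle hp ha, fun b hb => ⟨hL.invertMap hb.2, horth.2 (hinv hb)⟩,
    fun b hb b' hb' x he => (h x).span_eq_of_invert_eq hb hb' he,
    fun b hb => ⟨LieSphere.IsLegendreMap.umbilicMap h hq hr hb, horth.2 (humb hb)⟩,
    fun hM g => ⟨?_, ?_⟩⟩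
  · rintro ⟨hg, hgo⟩
    rw [horth] at hgo
    -- The classification at this single point supplies `b`; rigidity extends the equality to all of
    -- `M`.
    obtain ⟨x⟩ := hM.toNonempty
    rcases (h x).exists_eq_of_le hp (hg.1 x) (hgo x) with
      ⟨b, hb, e | e⟩ | ⟨b, hb, e | e⟩
    · exact ⟨_, Or.inl ⟨b, hb, rfl⟩, Or.inl (hL.eq_of_eq_at hp hg (hL.invertMap hb.2) h hq hr hgo
        (hinv hb) e)⟩
    · exact ⟨_, Or.inl ⟨b, hb, rfl⟩, Or.inr (hL.eq_of_eq_at hp hg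
        ((hL.invertMap hb.2).invertMap hp0) h hq hr hgo
        (fun y => LieSphere.invert_le hpmem (hinv hb y)) e)⟩
    · exact ⟨_, Or.inr ⟨b, hb, rfl⟩, Or.inl (hL.eq_of_eq_at hp hg
        (LieSphere.IsLegendreMap.umbilicMap h hq hr hb) h hq hr hgo (humb hb) e)⟩
    · exact ⟨_, Or.inr ⟨b, hb, rfl⟩, Or.inr (hL.eq_of_eq_at hp hg
        ((LieSphere.IsLegendreMap.umbilicMap h hq hr hb).invertMap hp0) h hq hr hgo
        (fun y => LieSphere.invert_le hpmem (humb hb y)) e)⟩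
  · rintro ⟨k, hk, hgk⟩
    have hk' : LieSphere.IsLegendreMap k ∧ ∀ x, k x ≤ f x ⊔ Submodule.span ℝ {a, p} := by
      rcases hk with ⟨b, hb, rfl⟩ | ⟨b, hb, rfl⟩
      · exact ⟨hL.invertMap hb.2, hinv hb⟩
      · exact ⟨LieSphere.IsLegendreMap.umbilicMap h hq hr hb, humb hb⟩
    rcases hgk with rfl | rfl
    · exact ⟨hk'.1, horth.2 hk'.2⟩
    · exact ⟨hk'.1.invertMap hp0, horth.2 fun x => LieSphere.invert_le hpmem (hk'.2 x)⟩
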